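/- Let $K\ge 1$, $k=\frac{K-1}{K+1}$ and $k^*=\frac{K^3-1}{K^3+1}$. There is a constant $c=c(K)>0$ such that the following holds. Let $\Omega\subset\mathbb C$ be open and let $\mathcal H:\Omega\times\mathbb C\to\mathbb C$ be such that $z\mapsto\mathcal H(z,\xi)$ is Lebesgue measurable for every $\xi\in\mathbb C$, $|\mathcal H(z,\xi_1)-\mathcal H(z,\xi_2)|\le k|\xi_1-\xi_2|$ for all $z\in\Omega$, $\xi_1,\xi_2\in\mathbb C$, and $\mathcal H(z,0)=0$ for all $z\in\Omega$. Then there is a function $\mathcal H^*:\Omega\times\mathbb C\to\mathbb C$ with the following properties. 1. For every homeomorphism $f:\Omega\to f(\Omega)$ onto an open set $f(\Omega)\subset\mathbb C$ with $f\in W^{1,2}_{\mathrm{loc}}(\Omega,\mathbb C)$ and $$\partial_{\bar z}f(z)=\mathcal H(z,\partial_z f(z))\qquad\text{for a.e. } z\in\Omega,$$ the inverse $g=f^{-1}$ belongs to $W^{1,2}_{\mathrm{loc}}(f(\Omega),\mathbb C)$ and satisfies $$\partial_{\bar\omega}g(\omega)=\mathcal H^*(g(\omega),\partial_\omega g(\omega))\qquad\text{for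 a.e. }\omega\in f(\Omega).$$ In particular, $\mathcal H^*$ does not depend on $f$. 2. The function $z\mapsto\mathcal H^*(z,\xi)$ is Lebesgue measurable on $\Omega$ for every $\xi\in\mathbb C$, $|\mathcal H^*(z,\xi_1)-\mathcal H^*(z,\xi_2)|\le k^*|\xi_1-\xi_2|$ for all $z\in\Omega$, $\xi_1,\xi_2\in\mathbb C$, and $\mathcal H^*(z,0)=0$ for all $z\in\Omega$. 3. If for some $\alpha\in(0,1)$ and $M\in\mathbb R$ $$|\mathcal H(z_1,\xi_1)-\mathcal H(z_2,\xi_2)|\le M|z_1-z_2|^\alpha(|\xi_1|+|\xi_2|)+k|\xi_1-\xi_2|$$ for all $z_1,z_2\in\Omega$, $\xi_1,\xi_2\in\mathbb C$, then $$|\mathcal H^*(z_1,\xi_1)-\mathcal H^*(z_2,\xi_2)|\le cM|z_1-z_2|^\alpha(|\xi_1|+|\xi_2|)+k^*|\xi_1-\xi_2|$$ for all $z_1,z_2\in\Omega$, $\xi_1,\xi_2\in\mathbb C$. Here $\partial_z=\frac12(\partial_x-i\partial_y)$ and $\partial_{\bar z}=\frac12(\partial_x+i\partial_y)$ are formed from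 weak partial derivatives. -/

import Mathlib

open MeasureTheory

/-- `u` belongs to `L²_loc(U)`: it is (measurable and) square integrable on every compact
subset of `U`. -/
def IsL2Loc (U : Set ℂ) (u : ℂ → ℂ) : Prop :=
  ∀ C : Set ℂ, IsCompact C → C ⊆ U → MemLp u 2 (volume.restrict C)

/-- `w` is the weak derivative of `u` on `U` in the direction `v`, tested against real
`C^∞` functions with compact support in `U`. -/
def HasWeakDirDeriv (U : Set ℂ) (u : ℂ → ℂ) (v : ℂ) (w : ℂ → ℂ) : Prop :=
  ∀ φ : ℂ → ℝ, ContDiff ℝ ((⊤ : ℕ∞) : WithTop ℕ∞) φ → HasCompactSupport φ → tsupport φ ⊆ U →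
    ∫ z in U, (fderiv ℝ φ z v) • u z = - ∫ z in U, φ z • w z

/-- `u ∈ W^{1,2}_loc(U)` with weak partial derivatives `ux = ∂u/∂x` and `uy = ∂u/∂y`. -/
structure HasW12LocPartials (U : Set ℂ) (u ux uy : ℂ → ℂ) : Prop where
  memL2 : IsL2Loc U u
  memL2_x : IsL2Loc U ux
  memL2_y : IsL2Loc U uy
  deriv_x : HasWeakDirDeriv U u 1 ux
  deriv_y : HasWeakDirDeriv U u Complex.I uy

/-- `∂_z u = (∂_x u - i ∂_y u) / 2`, in terms of the partial derivatives of `u`. -/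
noncomputable def wirtinger (ux uy : ℂ → ℂ) (z : ℂ) : ℂ := (ux z - Complex.I * uy z) / 2

/-- `∂_{z̄} u = (∂_x u + i ∂_y u) / 2`, in terms of the partial derivatives of `u`. -/
noncomputable def wirtingerBar (ux uy : ℂ → ℂ) (z : ℂ) : ℂ := (ux z + Complex.I * uy z) / 2

/-- `u ∈ W^{1,2}_loc(U)` and `∂_{z̄} u(z) = F(z, ∂_z u(z))` for almost every `z ∈ U`.
(The weak partial derivatives of `u` are unique up to null sets.) -/
def SolvesBeltrami (U : Set ℂ) (F : ℂ → ℂ → ℂ) (u : ℂ → ℂ) : Prop :=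
  ∃ ux uy : ℂ → ℂ, HasW12LocPartials U u ux uy ∧
    ∀ᵐ z ∂(volume.restrict U), wirtingerBar ux uy z = F z (wirtinger ux uy z)

/-- `F : U × ℂ → ℂ` is (Lebesgue) measurable on `U` in the first variable, `q`-Lipschitz in
the second one, and `F(z, 0) = 0`. Only the values of `F` on `U × ℂ` matter. Since `ℂ` is second
countable, almost everywhere measurability is the same as measurability with respect to the
σ-algebra of Lebesgue measurable sets. -/
structure IsStructureFunction (U : Set ℂ) (q : ℝ) (F : ℂ → ℂ → ℂ) : Prop where
  measurable_left : ∀ ξ : ℂ, AEMeasurable (fun z => F z ξ) (volume.restrict U)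
  lipschitz_right : ∀ z ∈ U, ∀ ξ₁ ξ₂ : ℂ, ‖F z ξ₁ - F z ξ₂‖ ≤ q * ‖ξ₁ - ξ₂‖
  map_zero : ∀ z ∈ U, F z 0 = 0

/-- The Hölder condition on `U × ℂ` with exponent `α`, Hölder constant `M` and Lipschitz
constant `q`. -/
def HolderCondition (U : Set ℂ) (α M q : ℝ) (F : ℂ → ℂ → ℂ) : Prop :=
  (∀ z₁ ∈ U, ∀ z₂ ∈ U, ∀ ξ₁ ξ₂ : ℂ,
    ‖F z₁ ξ₁ - F z₂ ξ₂‖ ≤ M * ‖z₁ - z₂‖ ^ α * (‖ξ₁‖ + ‖ξ₂‖) + q * ‖ξ₁ - ξ₂‖) ∧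
  ∀ z ∈ U, F z 0 = 0

open Filter Topology Metric
open scoped ENNReal Convolution ComplexConjugate Manifold

/-! Read a differential as the real linear map `ζ ↦ p ζ + q ζ̄` with `p = ∂f`, `q = ∂̄f`. The
equation says that `Df(z)` lies on the graph of `H z`. Since `Dg(ω)` should be the inverse of `Df(g
ω)`, the graph of `H* z` has to consist of the inverses of the maps on the graph of `H z`; this
depends on `H` alone.

Algebra. If `A`, `B` lie on the graph, then `A`, `B` and `B - A` are `K`-quasiconformal, because `H
z` is `k`-Lipschitz and vanishes at 0. Hence `A⁻¹ - B⁻¹ = A⁻¹ (B - A) B⁻¹` is `K³`-quasiconformal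
(`isQCPair_inv_sub_inv`), so the inverses again form a graph, and it is `k*`-Lipschitz. Every `ξ ≠
0` is reached: on a ray `p = r e` the `∂`-component of the inverse keeps a fixed direction and has
modulus between `1/r` and `K/r`, so the intermediate value theorem applies. The Hölder bound uses
the same factorization for two structure functions at a common `p`.

Analysis. It remains to show that `g` is in `W^{1,2}_loc` with derivative `(Df)⁻¹ ∘ g`. Everything
comes from one integration by parts, `integral_pullback_jacobian`, proved for smooth maps from the
divergence structure of Jacobians and extended by mollification. Inserting the constant 1 shows that
the push-forward of `J dz` under `f` has zero gradient, so it is `c dω` with `c` locally constant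
(`exists_density`). Here `c > 0`: otherwise `Df` vanishes on an open set and `f` is not injective.
This is a change of variables formula with no appeal to Lusin's condition, and the value of `c` is
irrelevant. Inserting the identity function, tested against `φ / c`, gives the weak derivatives of
`g` (`IsDensity.hasWeakDirDeriv_symm`). They are locally square integrable because `|Df|² ≤ 2K J`
bounds `J |(Df)⁻¹|²`. -/

/-! ### Quasiconformal real linear maps: composition, inverses, differences of inverses -/

/-- The real linear map `ζ ↦ p ζ + q ζ̄` is `K`-quasiconformal. -/
def IsQCPair (K : ℝ) (p q : ℂ) : Prop := (‖p‖ + ‖q‖) ^ 2 ≤ K * (‖p‖ ^ 2 - ‖q‖ ^ 2)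

/-- The defect `K (‖p‖² - ‖q‖²) - (‖p‖ + ‖q‖)²` factors as `(‖p‖ + ‖q‖) ((K - 1) ‖p‖ - (K + 1)
‖q‖)`. -/
theorem isQCPair_of_norm_le {K : ℝ} (hK : 1 ≤ K) {p q : ℂ}
    (h : ‖q‖ ≤ (K - 1) / (K + 1) * ‖p‖) : IsQCPair K p q := by
  have h1 : (K + 1) * ‖q‖ ≤ (K - 1) * ‖p‖ := by
    have := mul_le_mul_of_nonneg_left h (by linarith : 0 ≤ K + 1)
    have h2 : (K + 1) * ((K - 1) / (K + 1) * ‖p‖) = (K - 1) * ‖p‖ := by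
      field_simp
    linarith
  have h3 : 0 ≤ (‖p‖ + ‖q‖) * ((K - 1) * ‖p‖ - (K + 1) * ‖q‖) :=
    mul_nonneg (by positivity) (by linarith)
  unfold IsQCPair
  nlinarith

theorem IsQCPair.norm_le {K : ℝ} (hK : 1 ≤ K) {p q : ℂ} (h : IsQCPair K p q) :
    ‖q‖ ≤ (K - 1) / (K + 1) * ‖p‖ := by
  unfold IsQCPair at h
  have hp := norm_nonneg p
  have hq := norm_nonneg q
  rw [div_mul_eq_mul_div, le_div_iff₀ (by linarith)]
  rcases (add_nonneg hp hq).eq_or_lt with h0 | h0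
  · have : ‖p‖ = 0 := by linarith
    have : ‖q‖ = 0 := by linarith
    rw [‹‖p‖ = 0›, ‹‖q‖ = 0›]; simp
  · have : (‖p‖ + ‖q‖) * (‖p‖ + ‖q‖) ≤ (‖p‖ + ‖q‖) * (K * (‖p‖ - ‖q‖)) := by nlinarith
    have := le_of_mul_le_mul_left this h0
    linarith

theorem IsQCPair.det_nonneg {K : ℝ} (hK : 1 ≤ K) {p q : ℂ} (h : IsQCPair K p q) :
    0 ≤ ‖p‖ ^ 2 - ‖q‖ ^ 2 := by
  unfold IsQCPair at h
  by_contra! h1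
  nlinarith [sq_nonneg (‖p‖ + ‖q‖)]

theorem IsQCPair.det_pos {K : ℝ} (hK : 1 ≤ K) {p q : ℂ} (h : IsQCPair K p q) (hp : p ≠ 0) :
    0 < ‖p‖ ^ 2 - ‖q‖ ^ 2 := by
  have hp := norm_pos_iff.2 hp
  have hq := norm_nonneg q
  unfold IsQCPair at h
  by_contra! h1
  have : 0 < (‖p‖ + ‖q‖) ^ 2 := by positivity
  nlinarith

theorem norm_sq_comp_sub (a b c d : ℂ) :
    ‖a * c + b * star d‖ ^ 2 - ‖a * d + b * star c‖ ^ 2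
      = (‖a‖ ^ 2 - ‖b‖ ^ 2) * (‖c‖ ^ 2 - ‖d‖ ^ 2) := by
  simp only [← Complex.normSq_eq_norm_sq, Complex.normSq_apply, Complex.star_def]
  simp
  ring

/-- The pair in the conclusion is that of the composed linear maps. The determinant `‖a‖² - ‖b‖²` is
multiplicative and the operator norm `‖a‖ + ‖b‖` is submultiplicative. -/
theorem IsQCPair.comp {K L : ℝ} {a b c d : ℂ} (h : IsQCPair K a b) (h' : IsQCPair L c d) :
    IsQCPair (K * L) (a * c + b * star d) (a * d + b * star c) := by
  unfold IsQCPair at *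
  rw [norm_sq_comp_sub]
  have h1 : ‖a * c + b * star d‖ + ‖a * d + b * star c‖ ≤ (‖a‖ + ‖b‖) * (‖c‖ + ‖d‖) := by
    have e1 := norm_add_le (a * c) (b * star d)
    have e2 := norm_add_le (a * d) (b * star c)
    simp only [norm_mul, norm_star] at e1 e2
    linarith
  calc _ ≤ ((‖a‖ + ‖b‖) * (‖c‖ + ‖d‖)) ^ 2 := by gcongr
    _ = (‖a‖ + ‖b‖) ^ 2 * (‖c‖ + ‖d‖) ^ 2 := by ring
    _ ≤ _ := mul_le_mul h h' (by positivity) (le_trans (by positivity) h)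
    _ = _ := by ring

theorem IsQCPair.inv {K : ℝ} {p q : ℂ} (h : IsQCPair K p q) :
    IsQCPair K (star p / ((‖p‖ ^ 2 - ‖q‖ ^ 2 : ℝ) : ℂ)) (-q / ((‖p‖ ^ 2 - ‖q‖ ^ 2 : ℝ) : ℂ)) := by
  unfold IsQCPair at *
  simp only [norm_div, norm_star, norm_neg, Complex.norm_real, div_pow, ← sub_div, ← add_div]
  rw [← mul_div_assoc]
  gcongr

/-- This is `A⁻¹ - B⁻¹ = (A⁻¹ (B - A)) B⁻¹` in coordinates, with `(a, b)` the pair of `A⁻¹ (B - A)`.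
-/
theorem inv_sub_inv_pair {p₁ q₁ p₂ q₂ : ℂ} (h₁ : ‖p₁‖ ^ 2 - ‖q₁‖ ^ 2 ≠ 0)
    (h₂ : ‖p₂‖ ^ 2 - ‖q₂‖ ^ 2 ≠ 0) :
    let J₁ : ℂ := ((‖p₁‖ ^ 2 - ‖q₁‖ ^ 2 : ℝ) : ℂ)
    let J₂ : ℂ := ((‖p₂‖ ^ 2 - ‖q₂‖ ^ 2 : ℝ) : ℂ)
    let a := star p₁ / J₁ * (p₂ - p₁) + -q₁ / J₁ * star (q₂ - q₁)
    let b := star p₁ / J₁ * (q₂ - q₁) + -q₁ / J₁ * star (p₂ - p₁)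
    star p₁ / J₁ - star p₂ / J₂ = a * (star p₂ / J₂) + b * star (-q₂ / J₂) ∧
    -q₁ / J₁ - -q₂ / J₂ = a * (-q₂ / J₂) + b * star (star p₂ / J₂) := by
  intro J₁ J₂ a b
  have e₁ : J₁ = p₁ * star p₁ - q₁ * star q₁ := by
    simp only [J₁, Complex.star_def, Complex.mul_conj, Complex.normSq_eq_norm_sq]; push_cast; rfl
  have e₂ : J₂ = p₂ * star p₂ - q₂ * star q₂ := by
    simp only [J₂, Complex.star_def, Complex.mul_conj, Complex.normSq_eq_norm_sq]; push_cast; rfl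
  have n₁ : J₁ ≠ 0 := by simpa only [J₁, ne_eq, Complex.ofReal_eq_zero] using h₁
  have n₂ : J₂ ≠ 0 := by simpa only [J₂, ne_eq, Complex.ofReal_eq_zero] using h₂
  have s₂ : star J₂ = J₂ := by simp [J₂, -Complex.ofReal_sub, -Complex.ofReal_pow, Complex.conj_ofReal]
  simp only [a, b, star_sub, star_div₀, star_neg, star_star, s₂]
  constructor
  · field_simp
    rw [e₁, e₂]; ring
  · field_simp
    rw [e₁, e₂]; ring

/-- The difference of the inverses of two quasiconformal pairs with quasiconformal difference. -/
theorem isQCPair_inv_sub_inv {K : ℝ} (hK : 1 ≤ K) {p₁ q₁ p₂ q₂ : ℂ} (hp₁ : p₁ ≠ 0) (hp₂ : p₂ ≠ 0)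
    (h₁ : IsQCPair K p₁ q₁) (h₂ : IsQCPair K p₂ q₂) (h : IsQCPair K (p₂ - p₁) (q₂ - q₁)) :
    IsQCPair (K ^ 3)
      (star p₁ / ((‖p₁‖ ^ 2 - ‖q₁‖ ^ 2 : ℝ) : ℂ) - star p₂ / ((‖p₂‖ ^ 2 - ‖q₂‖ ^ 2 : ℝ) : ℂ))
      (-q₁ / ((‖p₁‖ ^ 2 - ‖q₁‖ ^ 2 : ℝ) : ℂ) - -q₂ / ((‖p₂‖ ^ 2 - ‖q₂‖ ^ 2 : ℝ) : ℂ)) := by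
  obtain ⟨e1, e2⟩ := inv_sub_inv_pair (h₁.det_pos hK hp₁).ne' (h₂.det_pos hK hp₂).ne'
  rw [e1, e2]
  -- Each of `A⁻¹`, `B - A` and `B⁻¹` contributes one factor `K`.
  have := (h₁.inv.comp h).comp h₂.inv
  rwa [show K * K * K = K ^ 3 by ring] at this

/-- The determinant of the inverse is the reciprocal of the determinant, so the common denominator
can be recovered and cleared. -/
theorem eq_of_inv_pair_eq {p₁ q₁ p₂ q₂ : ℂ} (h₁ : ‖p₁‖ ^ 2 - ‖q₁‖ ^ 2 ≠ 0)
    (h₂ : ‖p₂‖ ^ 2 - ‖q₂‖ ^ 2 ≠ 0)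
    (h0 : star p₁ / ((‖p₁‖ ^ 2 - ‖q₁‖ ^ 2 : ℝ) : ℂ) = star p₂ / ((‖p₂‖ ^ 2 - ‖q₂‖ ^ 2 : ℝ) : ℂ))
    (h0' : -q₁ / ((‖p₁‖ ^ 2 - ‖q₁‖ ^ 2 : ℝ) : ℂ) = -q₂ / ((‖p₂‖ ^ 2 - ‖q₂‖ ^ 2 : ℝ) : ℂ)) :
    p₁ = p₂ := by
  have hq (p q : ℂ) (h : ‖p‖ ^ 2 - ‖q‖ ^ 2 ≠ 0) :
      ‖star p / ((‖p‖ ^ 2 - ‖q‖ ^ 2 : ℝ) : ℂ)‖ ^ 2 - ‖-q / ((‖p‖ ^ 2 - ‖q‖ ^ 2 : ℝ) : ℂ)‖ ^ 2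
        = (‖p‖ ^ 2 - ‖q‖ ^ 2)⁻¹ := by
    simp only [norm_div, norm_star, norm_neg, Complex.norm_real, div_pow, ← sub_div, Real.norm_eq_abs,
      sq_abs]
    field_simp
  have e : ‖p₁‖ ^ 2 - ‖q₁‖ ^ 2 = ‖p₂‖ ^ 2 - ‖q₂‖ ^ 2 := by
    rw [← inv_inj, ← hq _ _ h₁, ← hq _ _ h₂, h0, h0']
  rw [e] at h0
  have : ((‖p₂‖ ^ 2 - ‖q₂‖ ^ 2 : ℝ) : ℂ) ≠ 0 := by exact_mod_cast h₂
  exact star_injective ((div_left_inj' this).1 h0)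

/-! ### The structure function of the inverse at a fixed point -/

/-- The `∂`-component of the inverse of `ζ ↦ p ζ + h(p) ζ̄`. -/
noncomputable def invDiff (h : ℂ → ℂ) (p : ℂ) : ℂ := star p / ((‖p‖ ^ 2 - ‖h p‖ ^ 2 : ℝ) : ℂ)

/-- The `∂̄`-component of the inverse of `ζ ↦ p ζ + h(p) ζ̄`. -/
noncomputable def invDiffBar (h : ℂ → ℂ) (p : ℂ) : ℂ := -h p / ((‖p‖ ^ 2 - ‖h p‖ ^ 2 : ℝ) : ℂ)

open Classical in
/-- The structure function of the inverse. -/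
noncomputable def invStructure (h : ℂ → ℂ) (ξ : ℂ) : ℂ :=
  -- For the functions `h` considered below, `p ≠ 0` reaches every `ξ ≠ 0` and never `ξ = 0`, so the
  -- default value is used exactly at 0.
  if H : ∃ p, p ≠ 0 ∧ invDiff h p = ξ then invDiffBar h H.choose else 0

section
variable {K : ℝ} {h : ℂ → ℂ}

theorem isQCPair_of_lipschitz (hK : 1 ≤ K)
    (hl : ∀ ξ₁ ξ₂, ‖h ξ₁ - h ξ₂‖ ≤ (K - 1) / (K + 1) * ‖ξ₁ - ξ₂‖) (h0 : h 0 = 0) (p : ℂ) :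
    IsQCPair K p (h p) :=
  isQCPair_of_norm_le hK (by simpa [h0] using hl p 0)

theorem isQCPair_invDiff_sub (hK : 1 ≤ K)
    (hl : ∀ ξ₁ ξ₂, ‖h ξ₁ - h ξ₂‖ ≤ (K - 1) / (K + 1) * ‖ξ₁ - ξ₂‖) (h0 : h 0 = 0) {p₁ p₂ : ℂ}
    (hp₁ : p₁ ≠ 0) (hp₂ : p₂ ≠ 0) :
    IsQCPair (K ^ 3) (invDiff h p₁ - invDiff h p₂) (invDiffBar h p₁ - invDiffBar h p₂) :=
  isQCPair_inv_sub_inv hK hp₁ hp₂ (isQCPair_of_lipschitz hK hl h0 p₁)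
    (isQCPair_of_lipschitz hK hl h0 p₂) (isQCPair_of_norm_le hK (hl _ _))

/-- Equal `∂`-components force equal `∂̄`-components by the `K³` bound, and then the linear maps
themselves coincide. -/
theorem invDiff_injOn (hK : 1 ≤ K)
    (hl : ∀ ξ₁ ξ₂, ‖h ξ₁ - h ξ₂‖ ≤ (K - 1) / (K + 1) * ‖ξ₁ - ξ₂‖) (h0 : h 0 = 0) {p₁ p₂ : ℂ}
    (hp₁ : p₁ ≠ 0) (hp₂ : p₂ ≠ 0) (e : invDiff h p₁ = invDiff h p₂) : p₁ = p₂ := by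
  have := (isQCPair_invDiff_sub hK hl h0 hp₁ hp₂).norm_le (one_le_pow₀ hK)
  rw [e, sub_self, norm_zero, mul_zero, norm_le_zero_iff, sub_eq_zero] at this
  exact eq_of_inv_pair_eq ((isQCPair_of_lipschitz hK hl h0 p₁).det_pos hK hp₁).ne'
    ((isQCPair_of_lipschitz hK hl h0 p₂).det_pos hK hp₂).ne' e this

theorem invStructure_invDiff (hK : 1 ≤ K)
    (hl : ∀ ξ₁ ξ₂, ‖h ξ₁ - h ξ₂‖ ≤ (K - 1) / (K + 1) * ‖ξ₁ - ξ₂‖) (h0 : h 0 = 0) {p : ℂ}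
    (hp : p ≠ 0) : invStructure h (invDiff h p) = invDiffBar h p := by
  have H : ∃ p', p' ≠ 0 ∧ invDiff h p' = invDiff h p := ⟨p, hp, rfl⟩
  rw [invStructure, dif_pos H, invDiff_injOn hK hl h0 H.choose_spec.1 hp H.choose_spec.2]

theorem invDiff_ne_zero (hK : 1 ≤ K)
    (hl : ∀ ξ₁ ξ₂, ‖h ξ₁ - h ξ₂‖ ≤ (K - 1) / (K + 1) * ‖ξ₁ - ξ₂‖) (h0 : h 0 = 0) {p : ℂ}
    (hp : p ≠ 0) : invDiff h p ≠ 0 := by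
  have := ((isQCPair_of_lipschitz hK hl h0 p).det_pos hK hp).ne'
  exact div_ne_zero (star_ne_zero.2 hp) (by exact_mod_cast this)

theorem invStructure_zero (hK : 1 ≤ K)
    (hl : ∀ ξ₁ ξ₂, ‖h ξ₁ - h ξ₂‖ ≤ (K - 1) / (K + 1) * ‖ξ₁ - ξ₂‖) (h0 : h 0 = 0) :
    invStructure h 0 = 0 := by
  rw [invStructure, dif_neg]
  rintro ⟨p, hp, e⟩
  exact invDiff_ne_zero hK hl h0 hp e

/-- The modulus of `invDiff h` along the ray through the unit vector `e`. -/
noncomputable def invRay (h : ℂ → ℂ) (e : ℂ) (r : ℝ) : ℝ := r / (r ^ 2 - ‖h (r * e)‖ ^ 2)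

theorem norm_smul_unit {e : ℂ} (he : ‖e‖ = 1) {r : ℝ} (hr : 0 < r) : ‖(r : ℂ) * e‖ = r := by
  rw [norm_mul, he, mul_one, Complex.norm_real, Real.norm_of_nonneg hr.le]

/-- The ray through `e` goes to the ray through the conjugate of `e`, which reduces surjectivity of
`invDiff h` to a real equation for the radius. -/
theorem invDiff_ray {e : ℂ} (he : ‖e‖ = 1) {r : ℝ} (hr : 0 < r) :
    invDiff h (r * e) = invRay h e r * star e := by
  rw [invDiff, invRay, norm_smul_unit he hr]
  simp
  ring

/-- The determinant is at most `r²`, and quasiconformality makes it at least `r² / K`. The bounds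
force blow-up at `r = 0` and decay at infinity. -/
theorem ray_bounds (hK : 1 ≤ K)
    (hl : ∀ ξ₁ ξ₂, ‖h ξ₁ - h ξ₂‖ ≤ (K - 1) / (K + 1) * ‖ξ₁ - ξ₂‖) (h0 : h 0 = 0)
    {e : ℂ} (he : ‖e‖ = 1) {r : ℝ} (hr : 0 < r) :
    0 < r ^ 2 - ‖h (r * e)‖ ^ 2 ∧ 1 / r ≤ invRay h e r ∧ invRay h e r ≤ K / r := by
  have h1 := isQCPair_of_lipschitz hK hl h0 (r * e)
  have h2 := h1.det_pos hK (by rw [← norm_pos_iff, norm_smul_unit he hr]; exact hr)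
  rw [IsQCPair, norm_smul_unit he hr] at h1
  rw [norm_smul_unit he hr] at h2
  refine ⟨h2, ?_, ?_⟩
  · rw [invRay, div_le_div_iff₀ hr h2]
    nlinarith [sq_nonneg ‖h (r * e)‖]
  · rw [invRay, div_le_div_iff₀ h2 hr]
    nlinarith [norm_nonneg (h (r * e)), sq_nonneg ‖h (r * e)‖]

theorem invRay_continuousOn (hK : 1 ≤ K)
    (hl : ∀ ξ₁ ξ₂, ‖h ξ₁ - h ξ₂‖ ≤ (K - 1) / (K + 1) * ‖ξ₁ - ξ₂‖) (h0 : h 0 = 0)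
    {e : ℂ} (he : ‖e‖ = 1) : ContinuousOn (invRay h e) (Set.Ioi 0) := by
  have hc : Continuous h := by
    have : LipschitzWith (Real.toNNReal ((K - 1) / (K + 1))) h :=
      LipschitzWith.of_dist_le' fun x y => by simpa [dist_eq_norm] using hl x y
    exact this.continuous
  refine ContinuousOn.div (by fun_prop) (by fun_prop) fun r hr => ?_
  exact (ray_bounds hK hl h0 he hr).1.ne'

/-- Besides existence, this lemma and the next record on which side of `t` the solution lies; the
measurability proof depends on that. -/
theorem exists_invRay_eq_lt (hK : 1 ≤ K)
    (hl : ∀ ξ₁ ξ₂, ‖h ξ₁ - h ξ₂‖ ≤ (K - 1) / (K + 1) * ‖ξ₁ - ξ₂‖) (h0 : h 0 = 0)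
    {e : ℂ} (he : ‖e‖ = 1) {t x : ℝ} (ht : 0 < t) (hx : invRay h e t < x) :
    ∃ r, 0 < r ∧ r < t ∧ invRay h e r = x := by
  have hx0 : 0 < x := lt_of_lt_of_le (by positivity) ((ray_bounds hK hl h0 he ht).2.1.trans hx.le)
  -- At a radius at most `1 / x` the lower bound `1 / r` already exceeds or equals `x`.
  have hs : 0 < min t (1 / x) := lt_min ht (by positivity)
  have h1 : x ≤ invRay h e (min t (1 / x)) := by
    refine le_trans ?_ (ray_bounds hK hl h0 he hs).2.1
    rw [le_div_comm₀ hx0 hs]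
    exact min_le_right _ _
  have := intermediate_value_Icc' (min_le_left t (1 / x)) ((invRay_continuousOn hK hl h0 he).mono
    fun y hy => hs.trans_le hy.1)
  obtain ⟨r, hr, e⟩ := this ⟨hx.le, h1⟩
  refine ⟨r, hs.trans_le hr.1, lt_of_le_of_ne hr.2 ?_, e⟩
  rintro rfl
  exact hx.ne e

theorem exists_invRay_eq_ge (hK : 1 ≤ K)
    (hl : ∀ ξ₁ ξ₂, ‖h ξ₁ - h ξ₂‖ ≤ (K - 1) / (K + 1) * ‖ξ₁ - ξ₂‖) (h0 : h 0 = 0)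
    {e : ℂ} (he : ‖e‖ = 1) {t x : ℝ} (ht : 0 < t) (hx0 : 0 < x) (hx : x ≤ invRay h e t) :
    ∃ r, t ≤ r ∧ invRay h e r = x := by
  have hs : 0 < max t (K / x) := lt_max_of_lt_left ht
  have h1 : invRay h e (max t (K / x)) ≤ x := by
    refine le_trans (ray_bounds hK hl h0 he hs).2.2 ?_
    rw [div_le_comm₀ hs hx0]
    exact le_max_right _ _
  have := intermediate_value_Icc' (le_max_left t (K / x)) ((invRay_continuousOn hK hl h0 he).mono
    fun y hy => ht.trans_le hy.1)
  obtain ⟨r, hr, e⟩ := this ⟨h1, hx⟩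
  exact ⟨r, hr.1, e⟩

theorem invRay_injOn (hK : 1 ≤ K)
    (hl : ∀ ξ₁ ξ₂, ‖h ξ₁ - h ξ₂‖ ≤ (K - 1) / (K + 1) * ‖ξ₁ - ξ₂‖) (h0 : h 0 = 0)
    {e : ℂ} (he : ‖e‖ = 1) : Set.InjOn (invRay h e) (Set.Ioi 0) := by
  intro r hr s hs hrs
  have he0 : e ≠ 0 := by rintro rfl; simp at he
  have h1 : invDiff h (r * e) = invDiff h (s * e) := by
    rw [invDiff_ray he hr, invDiff_ray he hs, hrs]
  have := invDiff_injOn hK hl h0 (mul_ne_zero (by simpa using (hr : 0 < r).ne') he0)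
    (mul_ne_zero (by simpa using (hs : 0 < s).ne') he0) h1
  simpa [he0] using this

theorem exists_invRay_eq (hK : 1 ≤ K)
    (hl : ∀ ξ₁ ξ₂, ‖h ξ₁ - h ξ₂‖ ≤ (K - 1) / (K + 1) * ‖ξ₁ - ξ₂‖) (h0 : h 0 = 0)
    {e : ℂ} (he : ‖e‖ = 1) {x : ℝ} (hx : 0 < x) : ∃ r, 0 < r ∧ invRay h e r = x := by
  rcases lt_or_ge (invRay h e 1) x with h1 | h1
  · obtain ⟨r, hr, -, e⟩ := exists_invRay_eq_lt hK hl h0 he one_pos h1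
    exact ⟨r, hr, e⟩
  · obtain ⟨r, hr, e⟩ := exists_invRay_eq_ge hK hl h0 he one_pos hx h1
    exact ⟨r, one_pos.trans_le hr, e⟩

theorem norm_unit_star {ξ : ℂ} (hξ : ξ ≠ 0) : ‖star ξ / (‖ξ‖ : ℂ)‖ = 1 := by
  rw [norm_div, norm_star, Complex.norm_real, norm_norm, div_self (norm_ne_zero_iff.2 hξ)]

theorem invDiff_ray_of_invRay_eq {ξ : ℂ} (hξ : ξ ≠ 0) {r : ℝ} (hr : 0 < r)
    (e : invRay h (star ξ / (‖ξ‖ : ℂ)) r = ‖ξ‖) : invDiff h (r * (star ξ / (‖ξ‖ : ℂ))) = ξ := by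
  have : (‖ξ‖ : ℂ) ≠ 0 := by simpa using hξ
  rw [invDiff_ray (norm_unit_star hξ) hr, e]
  simp
  field_simp

theorem exists_invDiff_eq (hK : 1 ≤ K)
    (hl : ∀ ξ₁ ξ₂, ‖h ξ₁ - h ξ₂‖ ≤ (K - 1) / (K + 1) * ‖ξ₁ - ξ₂‖) (h0 : h 0 = 0)
    {ξ : ℂ} (hξ : ξ ≠ 0) : ∃ p, p ≠ 0 ∧ invDiff h p = ξ := by
  obtain ⟨r, hr, e⟩ := exists_invRay_eq hK hl h0 (norm_unit_star hξ) (norm_pos_iff.2 hξ)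
  refine ⟨_, ?_, invDiff_ray_of_invRay_eq hξ hr e⟩
  rw [← norm_pos_iff, norm_smul_unit (norm_unit_star hξ) hr]
  exact hr

theorem lipschitz_invStructure (hK : 1 ≤ K)
    (hl : ∀ ξ₁ ξ₂, ‖h ξ₁ - h ξ₂‖ ≤ (K - 1) / (K + 1) * ‖ξ₁ - ξ₂‖) (h0 : h 0 = 0) (ξ₁ ξ₂ : ℂ) :
    ‖invStructure h ξ₁ - invStructure h ξ₂‖ ≤ (K ^ 3 - 1) / (K ^ 3 + 1) * ‖ξ₁ - ξ₂‖ := by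
  have hK3 : 1 ≤ K ^ 3 := one_le_pow₀ hK
  -- The value 0 is not attained by `invDiff`, so comparison with it is separate: the inverse pair
  -- is itself `K`-quasiconformal, hence `K³`-quasiconformal.
  have key (ξ : ℂ) : ‖invStructure h ξ‖ ≤ (K ^ 3 - 1) / (K ^ 3 + 1) * ‖ξ‖ := by
    rcases eq_or_ne ξ 0 with rfl | hξ
    · simp [invStructure_zero hK hl h0]
    · obtain ⟨p, hp, rfl⟩ := exists_invDiff_eq hK hl h0 hξ
      rw [invStructure_invDiff hK hl h0 hp]
      refine IsQCPair.norm_le hK3 ?_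
      refine le_trans (isQCPair_of_lipschitz hK hl h0 p).inv ?_
      have h1 := (isQCPair_of_lipschitz hK hl h0 p).inv.det_nonneg hK
      have h2 : K ≤ K ^ 3 := le_self_pow₀ hK (by norm_num)
      exact mul_le_mul_of_nonneg_right h2 h1
  rcases eq_or_ne ξ₁ 0 with rfl | hξ₁
  · simpa [invStructure_zero hK hl h0] using key ξ₂
  rcases eq_or_ne ξ₂ 0 with rfl | hξ₂
  · simpa [invStructure_zero hK hl h0] using key ξ₁
  obtain ⟨p₁, hp₁, rfl⟩ := exists_invDiff_eq hK hl h0 hξ₁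
  obtain ⟨p₂, hp₂, rfl⟩ := exists_invDiff_eq hK hl h0 hξ₂
  rw [invStructure_invDiff hK hl h0 hp₁, invStructure_invDiff hK hl h0 hp₂]
  exact (isQCPair_invDiff_sub hK hl h0 hp₁ hp₂).norm_le hK3
end

/-! ### Dependence on the point: Hölder condition and measurability -/

section
variable {K : ℝ}

theorem norm_inv_pair_le (hK : 1 ≤ K) {p q : ℂ} (hp : p ≠ 0) (h : IsQCPair K p q) :
    ‖star p / ((‖p‖ ^ 2 - ‖q‖ ^ 2 : ℝ) : ℂ)‖ + ‖-q / ((‖p‖ ^ 2 - ‖q‖ ^ 2 : ℝ) : ℂ)‖ ≤ K / ‖p‖ := by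
  have hd := h.det_pos hK hp
  have hp := norm_pos_iff.2 hp
  simp only [norm_div, norm_star, norm_neg, Complex.norm_real, Real.norm_of_nonneg hd.le, ← add_div]
  rw [div_le_div_iff₀ hd hp]
  unfold IsQCPair at h
  nlinarith [norm_nonneg q]

theorem norm_comp_add_le (a b c d : ℂ) :
    ‖a * c + b * star d‖ + ‖a * d + b * star c‖ ≤ (‖a‖ + ‖b‖) * (‖c‖ + ‖d‖) := by
  have e1 := norm_add_le (a * c) (b * star d)
  have e2 := norm_add_le (a * d) (b * star c)
  simp only [norm_mul, norm_star] at e1 e2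
  linarith

/-- With a common `p`, the middle factor of `A⁻¹ (B - A) B⁻¹` is the pair `(0, q₂ - q₁)`, while each
inverse has norm at most `K / ‖p‖`. -/
theorem norm_inv_sub_inv_le (hK : 1 ≤ K) {p q₁ q₂ : ℂ} (hp : p ≠ 0)
    (h₁ : IsQCPair K p q₁) (h₂ : IsQCPair K p q₂) :
    ‖star p / ((‖p‖ ^ 2 - ‖q₁‖ ^ 2 : ℝ) : ℂ) - star p / ((‖p‖ ^ 2 - ‖q₂‖ ^ 2 : ℝ) : ℂ)‖ +
    ‖-q₁ / ((‖p‖ ^ 2 - ‖q₁‖ ^ 2 : ℝ) : ℂ) - -q₂ / ((‖p‖ ^ 2 - ‖q₂‖ ^ 2 : ℝ) : ℂ)‖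
      ≤ K / ‖p‖ * ‖q₁ - q₂‖ * (K / ‖p‖) := by
  obtain ⟨e1, e2⟩ := inv_sub_inv_pair (h₁.det_pos hK hp).ne' (h₂.det_pos hK hp).ne'
  rw [e1, e2]
  refine (norm_comp_add_le _ _ _ _).trans ?_
  gcongr
  · refine (norm_comp_add_le _ _ _ _).trans ?_
    rw [sub_self, norm_zero, zero_add, norm_sub_rev]
    gcongr
    exact norm_inv_pair_le hK hp h₁
  · exact norm_inv_pair_le hK hp h₂

theorem one_div_norm_le_norm_inv {p q : ℂ} (hp : p ≠ 0) (hd : 0 < ‖p‖ ^ 2 - ‖q‖ ^ 2) :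
    1 / ‖p‖ ≤ ‖star p / ((‖p‖ ^ 2 - ‖q‖ ^ 2 : ℝ) : ℂ)‖ := by
  have hp := norm_pos_iff.2 hp
  rw [norm_div, norm_star, Complex.norm_real, Real.norm_of_nonneg hd.le, div_le_div_iff₀ hp hd]
  nlinarith [sq_nonneg ‖q‖]

/-- For `ξ₂ ≠ 0`, write `ξ₂ = invDiff h₂ p` and pass through the point `invDiff h₁ p` with the same
`p`. The Lipschitz bound for `h₁` handles the move from `ξ₁`; changing `h₁` to `h₂` costs at most `2
K² δ ‖ξ₂‖`, within the stated constant. -/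
theorem norm_invStructure_sub_le (hK : 1 ≤ K) {h₁ h₂ : ℂ → ℂ} {δ : ℝ} (hδ : 0 ≤ δ)
    (hl₁ : ∀ ξ₁ ξ₂, ‖h₁ ξ₁ - h₁ ξ₂‖ ≤ (K - 1) / (K + 1) * ‖ξ₁ - ξ₂‖) (h0₁ : h₁ 0 = 0)
    (hl₂ : ∀ ξ₁ ξ₂, ‖h₂ ξ₁ - h₂ ξ₂‖ ≤ (K - 1) / (K + 1) * ‖ξ₁ - ξ₂‖) (h0₂ : h₂ 0 = 0)
    (hd : ∀ p, ‖h₁ p - h₂ p‖ ≤ 2 * δ * ‖p‖) (ξ₁ ξ₂ : ℂ) :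
    ‖invStructure h₁ ξ₁ - invStructure h₂ ξ₂‖ ≤
      4 * K ^ 2 * δ * (‖ξ₁‖ + ‖ξ₂‖) + (K ^ 3 - 1) / (K ^ 3 + 1) * ‖ξ₁ - ξ₂‖ := by
  have hK3 : 1 ≤ K ^ 3 := one_le_pow₀ hK
  set k := (K ^ 3 - 1) / (K ^ 3 + 1) with hk
  have hk0 : 0 ≤ k := div_nonneg (by linarith) (by linarith)
  have hk1 : k ≤ 1 := by rw [hk, div_le_one (by linarith)]; linarith
  rcases eq_or_ne ξ₂ 0 with rfl | hξ₂
  · rw [invStructure_zero hK hl₂ h0₂]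
    have := lipschitz_invStructure hK hl₁ h0₁ ξ₁ 0
    rw [invStructure_zero hK hl₁ h0₁] at this
    have h3 : 0 ≤ 4 * K ^ 2 * δ * (‖ξ₁‖ + ‖(0 : ℂ)‖) := by positivity
    linarith
  obtain ⟨p, hp, rfl⟩ := exists_invDiff_eq hK hl₂ h0₂ hξ₂
  rw [invStructure_invDiff hK hl₂ h0₂ hp]
  have q₁ := isQCPair_of_lipschitz hK hl₁ h0₁ p
  have q₂ := isQCPair_of_lipschitz hK hl₂ h0₂ p
  have hp' := norm_pos_iff.2 hp
  have h1 : ‖invDiff h₁ p - invDiff h₂ p‖ + ‖invDiffBar h₁ p - invDiffBar h₂ p‖ ≤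
      2 * K ^ 2 * δ * ‖invDiff h₂ p‖ := by
    refine (norm_inv_sub_inv_le hK hp q₁ q₂).trans ?_
    calc K / ‖p‖ * ‖h₁ p - h₂ p‖ * (K / ‖p‖) ≤ K / ‖p‖ * (2 * δ * ‖p‖) * (K / ‖p‖) := by
          gcongr; exact hd p
      _ = 2 * K ^ 2 * δ * (1 / ‖p‖) := by field_simp
      _ ≤ _ := by
          gcongr
          exact one_div_norm_le_norm_inv hp (q₂.det_pos hK hp)
  have h2 := lipschitz_invStructure hK hl₁ h0₁ ξ₁ (invDiff h₁ p)
  rw [invStructure_invDiff hK hl₁ h0₁ hp] at h2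
  have h3 : ‖ξ₁ - invDiff h₁ p‖ ≤ ‖ξ₁ - invDiff h₂ p‖ + ‖invDiff h₁ p - invDiff h₂ p‖ := by
    rw [norm_sub_rev (invDiff h₁ p)]; exact norm_sub_le_norm_sub_add_norm_sub _ _ _
  have h4 : ‖invStructure h₁ ξ₁ - invDiffBar h₂ p‖ ≤ ‖invStructure h₁ ξ₁ - invDiffBar h₁ p‖ +
    ‖invDiffBar h₁ p - invDiffBar h₂ p‖ := norm_sub_le_norm_sub_add_norm_sub _ _ _
  have h5 : k * ‖ξ₁ - invDiff h₁ p‖ ≤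
      k * ‖ξ₁ - invDiff h₂ p‖ + ‖invDiff h₁ p - invDiff h₂ p‖ := by
    nlinarith [norm_nonneg (invDiff h₁ p - invDiff h₂ p)]
  have h6 : 0 ≤ 4 * K ^ 2 * δ * ‖ξ₁‖ := by positivity
  have h7 : 0 ≤ 2 * K ^ 2 * δ * ‖invDiff h₂ p‖ := by positivity
  linarith

theorem IsStructureFunction.holderCondition_inv (hK : 1 ≤ K) {Ω : Set ℂ} {H : ℂ → ℂ → ℂ}
    (hH : IsStructureFunction Ω ((K - 1) / (K + 1)) H)
    {α M : ℝ} (h : HolderCondition Ω α M ((K - 1) / (K + 1)) H) :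
    HolderCondition Ω α (4 * K ^ 2 * M) ((K ^ 3 - 1) / (K ^ 3 + 1))
      (fun z => invStructure (H z)) := by
  refine ⟨fun z₁ hz₁ z₂ hz₂ ξ₁ ξ₂ => ?_, fun z hz =>
    invStructure_zero hK (hH.lipschitz_right z hz) (hH.map_zero z hz)⟩
  have hd (p : ℂ) : ‖H z₁ p - H z₂ p‖ ≤ 2 * (M * ‖z₁ - z₂‖ ^ α) * ‖p‖ := by
    have := h.1 z₁ hz₁ z₂ hz₂ p p
    rw [sub_self, norm_zero, mul_zero, add_zero] at this
    linarith
  -- No sign of `M` is assumed; the Hölder inequality at `p = 1` supplies this one.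
  have hδ : 0 ≤ M * ‖z₁ - z₂‖ ^ α := by
    have := (norm_nonneg _).trans (hd 1)
    rw [norm_one] at this
    linarith
  have := norm_invStructure_sub_le hK hδ (hH.lipschitz_right z₁ hz₁) (hH.map_zero z₁ hz₁)
    (hH.lipschitz_right z₂ hz₂) (hH.map_zero z₂ hz₂) hd ξ₁ ξ₂
  simpa only [mul_assoc] using this

/-- Superposition with a Carathéodory function preserves almost everywhere measurability. -/
theorem aemeasurable_caratheodory {μ : Measure ℂ} {Ω : Set ℂ} (hΩ : MeasurableSet Ω)
    {H : ℂ → ℂ → ℂ} (hc : ∀ z ∈ Ω, Continuous (H z))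
    (hm : ∀ ξ, AEMeasurable (fun z => H z ξ) (μ.restrict Ω)) {r : ℂ → ℂ}
    (hr : AEMeasurable r (μ.restrict Ω)) :
    AEMeasurable (fun z => H z (r z)) (μ.restrict Ω) := by
  classical
  -- Over the σ-algebra of null measurable sets each section is genuinely measurable, so no
  -- exceptional null set depends on `ξ` and joint measurability follows.
  let m : MeasurableSpace (NullMeasurableSpace ℂ (μ.restrict Ω)) := inferInstance
  let u : ℂ → NullMeasurableSpace ℂ (μ.restrict Ω) → ℂ := fun ξ z => Ω.indicator (fun z => H z ξ) z
  have hu : Measurable (Function.uncurry u) := by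
    refine measurable_uncurry_of_continuous_of_measurable (fun z => ?_) (fun ξ => ?_)
    · by_cases hz : z ∈ Ω
      · exact (hc z hz).congr fun ξ => (Set.indicator_of_mem hz fun z => H z ξ).symm
      · exact continuous_const.congr fun ξ => (Set.indicator_of_notMem hz fun z => H z ξ).symm
    · exact ((hm ξ).indicator hΩ).nullMeasurable
  have hr' : Measurable (fun z : NullMeasurableSpace ℂ (μ.restrict Ω) => r z) := hr.nullMeasurable
  have h2 : Measurable (fun z : NullMeasurableSpace ℂ (μ.restrict Ω) => u (r z) z) :=
    hu.comp (hr'.prodMk measurable_id)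
  have h3 : AEMeasurable (fun z => u (r z) z) (μ.restrict Ω) := NullMeasurable.aemeasurable h2
  refine h3.congr ?_
  filter_upwards [ae_restrict_mem hΩ] with z hz
  simp [u, Set.indicator_of_mem hz]

/-- The preimage of `ξ` on its ray has a unique radius `r z`. For `t > 0`, `r z < t` is equivalent
to `invRay (H z) e t < ‖ξ‖`, a condition measurable in `z`; then `H z` is evaluated at the
measurable point `r z * e`. -/
theorem aemeasurable_invStructure (hK : 1 ≤ K) {Ω : Set ℂ} (hΩ : IsOpen Ω) {H : ℂ → ℂ → ℂ}
    (hH : IsStructureFunction Ω ((K - 1) / (K + 1)) H) (ξ : ℂ) :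
    AEMeasurable (fun z => invStructure (H z) ξ) (volume.restrict Ω) := by
  classical
  rcases eq_or_ne ξ 0 with rfl | hξ
  · refine (aemeasurable_const (b := (0 : ℂ))).congr ?_
    filter_upwards [ae_restrict_mem hΩ.measurableSet] with z hz
    exact (invStructure_zero hK (hH.lipschitz_right z hz) (hH.map_zero z hz)).symm
  have hx : 0 < ‖ξ‖ := norm_pos_iff.2 hξ
  set e := star ξ / (‖ξ‖ : ℂ) with he
  have he1 : ‖e‖ = 1 := norm_unit_star hξ
  have hex (z : ℂ) : ∃ r : ℝ, z ∈ Ω → 0 < r ∧ invRay (H z) e r = ‖ξ‖ := by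
    by_cases hz : z ∈ Ω
    · obtain ⟨r, hr⟩ := exists_invRay_eq hK (hH.lipschitz_right z hz) (hH.map_zero z hz) he1 hx
      exact ⟨r, fun _ => hr⟩
    · exact ⟨0, fun h => absurd h hz⟩
  choose r hr using hex
  have hray (t : ℝ) : AEMeasurable (fun z => invRay (H z) e t) (volume.restrict Ω) := by
    unfold invRay
    have := hH.measurable_left (t * e)
    fun_prop
  have hlt (z : ℂ) (hz : z ∈ Ω) (t : ℝ) : r z < t ↔ 0 < t ∧ invRay (H z) e t < ‖ξ‖ := by
    have hl := hH.lipschitz_right z hz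
    have h0 := hH.map_zero z hz
    have inj := invRay_injOn hK hl h0 he1
    constructor
    · intro h
      have ht := (hr z hz).1.trans h
      refine ⟨ht, ?_⟩
      by_contra! h2
      obtain ⟨s, hs, hs'⟩ := exists_invRay_eq_ge hK hl h0 he1 ht hx h2
      have := inj (ht.trans_le hs) (hr z hz).1 (hs'.trans (hr z hz).2.symm)
      linarith
    · rintro ⟨ht, h⟩
      obtain ⟨s, hs, hst, hs'⟩ := exists_invRay_eq_lt hK hl h0 he1 ht h
      have := inj hs (hr z hz).1 (hs'.trans (hr z hz).2.symm)
      linarith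
  have hrm : AEMeasurable (Ω.indicator r) (volume.restrict Ω) := by
    refine NullMeasurable.aemeasurable (measurable_of_Iio
      (δ := NullMeasurableSpace ℂ (volume.restrict Ω)) fun t => ?_)
    have h1 : NullMeasurableSet ({z | invRay (H z) e t < ‖ξ‖}) (volume.restrict Ω) :=
      (hray t).nullMeasurable measurableSet_Iio
    have h2 : NullMeasurableSet (Ω.indicator r ⁻¹' Set.Iio t) (volume.restrict Ω) := by
      by_cases ht : 0 < t
      · refine h1.congr ?_
        filter_upwards [ae_restrict_mem hΩ.measurableSet] with z hz
        apply propext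
        change invRay (H z) e t < ‖ξ‖ ↔ Ω.indicator r z < t
        rw [Set.indicator_of_mem hz, hlt z hz]
        simp [ht]
      · refine (nullMeasurableSet_empty).congr ?_
        filter_upwards [ae_restrict_mem hΩ.measurableSet] with z hz
        apply propext
        change False ↔ Ω.indicator r z < t
        rw [Set.indicator_of_mem hz, hlt z hz]
        simp [ht]
    exact h2
  have hw : AEMeasurable (fun z => (Ω.indicator r z * e : ℂ)) (volume.restrict Ω) := by fun_prop
  have hHr : AEMeasurable (fun z => H z (Ω.indicator r z * e)) (volume.restrict Ω) := by
    refine aemeasurable_caratheodory hΩ.measurableSet (fun z hz => ?_) hH.measurable_left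
      hw
    have : LipschitzWith (Real.toNNReal ((K - 1) / (K + 1))) (H z) :=
      LipschitzWith.of_dist_le' fun x y => by
        simpa [dist_eq_norm] using hH.lipschitz_right z hz x y
    exact this.continuous
  have key : AEMeasurable (fun z => -H z (Ω.indicator r z * e) /
      ((‖(Ω.indicator r z * e : ℂ)‖ ^ 2 - ‖H z (Ω.indicator r z * e)‖ ^ 2 : ℝ) : ℂ))
      (volume.restrict Ω) :=
    hHr.neg.div (Complex.measurable_ofReal.comp_aemeasurable
      ((hw.norm.pow_const 2).sub (hHr.norm.pow_const 2)))
  refine key.congr ?_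
  filter_upwards [ae_restrict_mem hΩ.measurableSet] with z hz
  rw [Set.indicator_of_mem hz]
  have h1 := invDiff_ray_of_invRay_eq hξ (hr z hz).1 (hr z hz).2
  have hne : (r z : ℂ) * e ≠ 0 := by
    rw [← norm_pos_iff, norm_smul_unit he1 (hr z hz).1]; exact (hr z hz).1
  have h2 := invStructure_invDiff hK (hH.lipschitz_right z hz) (hH.map_zero z hz) hne
  rw [he] at h2 ⊢
  rw [h1] at h2
  rw [h2, invDiffBar]

theorem IsStructureFunction.inv (hK : 1 ≤ K) {Ω : Set ℂ} (hΩ : IsOpen Ω) {H : ℂ → ℂ → ℂ}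
    (hH : IsStructureFunction Ω ((K - 1) / (K + 1)) H) :
    IsStructureFunction Ω ((K ^ 3 - 1) / (K ^ 3 + 1)) (fun z => invStructure (H z)) where
  measurable_left := aemeasurable_invStructure hK hΩ hH
  lipschitz_right z hz := lipschitz_invStructure hK (hH.lipschitz_right z hz) (hH.map_zero z hz)
  map_zero z hz := invStructure_zero hK (hH.lipschitz_right z hz) (hH.map_zero z hz)
end

/-! ### Vector-valued measures with vanishing distributional gradient -/

section Constancy
variable {E : Type*} [NormedAddCommGroup E] [NormedSpace ℝ E]

theorem integrable_bounded_smul {μ : Measure ℂ} {h : ℂ → E} (hh : Integrable h μ) {φ : ℂ → ℝ}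
    (hφ : Continuous φ) (hc : HasCompactSupport φ) : Integrable (fun z => φ z • h z) μ := by
  obtain ⟨C, hC⟩ := hc.exists_bound_of_continuous hφ
  exact hh.bdd_smul C hφ.aestronglyMeasurable (Eventually.of_forall hC)

/-- If the gradient of `h μ` vanishes on a ball, its action on test functions is invariant under
small translations. -/
theorem integral_translate_eq {μ : Measure ℂ} {h : ℂ → E} (hh : Integrable h μ) {c₀ : ℂ} {R : ℝ}
    (H : ∀ φ : ℂ → ℝ, ContDiff ℝ ((⊤ : ℕ∞) : WithTop ℕ∞) φ → HasCompactSupport φ →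
      tsupport φ ⊆ ball c₀ (2 * R) → ∀ v, ∫ z, fderiv ℝ φ z v • h z ∂μ = 0)
    {φ : ℂ → ℝ} (hφ : ContDiff ℝ ((⊤ : ℕ∞) : WithTop ℕ∞) φ) (hc : HasCompactSupport φ)
    (hs : tsupport φ ⊆ ball c₀ R) {y : ℂ} (hy : ‖y‖ < R) :
    ∫ z, φ (z - y) • h z ∂μ = ∫ z, φ z • h z ∂μ := by
  have hcd : Continuous (fderiv ℝ φ) := hφ.continuous_fderiv (by simp)
  obtain ⟨C, hC⟩ := (hc.fderiv ℝ).exists_bound_of_continuous hcd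
  -- Differentiate along the segment of translates `φ (· - t y)`. For `0 ≤ t ≤ 1` their supports
  -- stay in the ball of radius `2R`, where the gradient vanishes.
  have hd (t : ℝ) : HasDerivAt (fun t : ℝ => ∫ z, φ (z - t * y) • h z ∂μ)
      (∫ z, fderiv ℝ φ (z - t * y) (-y) • h z ∂μ) t := by
    refine (hasDerivAt_integral_of_dominated_loc_of_deriv_le (s := Set.univ)
      (bound := fun z => C * ‖y‖ * ‖h z‖)
      (F' := fun (t : ℝ) z => fderiv ℝ φ (z - t * y) (-y) • h z)
      univ_mem (Eventually.of_forall fun t => ?_) ?_ ?_ ?_ ?_ ?_).2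
    · exact ((hφ.continuous.comp (by fun_prop)).aestronglyMeasurable).smul hh.aestronglyMeasurable
    · refine integrable_bounded_smul (φ := fun z => φ (z - t * y)) hh
        (hφ.continuous.comp (by fun_prop)) ?_
      exact hc.comp_homeomorph (Homeomorph.subRight (t * y : ℂ))
    · exact (((hcd.comp (by fun_prop)).clm_apply continuous_const).aestronglyMeasurable).smul
        hh.aestronglyMeasurable
    · refine Eventually.of_forall fun z t _ => ?_
      rw [norm_smul]
      gcongr
      refine (ContinuousLinearMap.le_opNorm _ _).trans ?_
      rw [norm_neg]
      gcongr
      exact hC _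
    · exact hh.norm.const_mul _
    · refine Eventually.of_forall fun z t _ => ?_
      have h1 : HasDerivAt (fun t : ℝ => z - t * y) (-y) t := by
        simpa using ((Complex.ofRealCLM.hasDerivAt (x := t)).mul_const y).const_sub z
      have h2 := ((hφ.differentiable (by simp)) (z - t * y)).hasFDerivAt
      exact (h2.comp_hasDerivAt t h1).smul_const (h z)
  have hzero (t : ℝ) (ht : t ∈ Set.Ico (0 : ℝ) 1) :
      ∫ z, fderiv ℝ φ (z - t * y) (-y) • h z ∂μ = 0 := by
    have := H (fun z => φ (z - t * y)) (hφ.comp (by fun_prop))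
      (hc.comp_homeomorph (Homeomorph.subRight (t * y : ℂ))) ?_ (-y)
    · simpa only [fderiv_comp_sub] using this
    · have h1 : tsupport (fun z => φ (z - t * y)) = (fun z => z - t * y) ⁻¹' tsupport φ :=
        tsupport_comp_eq_preimage φ (Homeomorph.subRight (t * y : ℂ))
      rw [h1]
      intro z hz
      have h2 := hs hz
      rw [mem_ball, dist_eq_norm] at h2 ⊢
      have h3 : ‖(t : ℂ) * y‖ ≤ ‖y‖ := by
        rw [norm_mul, Complex.norm_real, Real.norm_of_nonneg ht.1]
        exact mul_le_of_le_one_left (norm_nonneg _) ht.2.le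
      calc ‖z - c₀‖ = ‖(z - t * y - c₀) + t * y‖ := by ring_nf
        _ ≤ ‖z - t * y - c₀‖ + ‖(t : ℂ) * y‖ := norm_add_le _ _
        _ < _ := by linarith
  have := constant_of_has_deriv_right_zero (a := 0) (b := 1)
    (fun t _ => (hd t).continuousAt.continuousWithinAt)
    (fun t ht => by have := (hd t).hasDerivWithinAt (s := Set.Ici t); rwa [hzero t ht] at this)
    1 ⟨zero_le_one, le_rfl⟩
  simpa using this

/-- If the gradient of `h μ` vanishes on a ball, then `h μ` is a constant multiple of Lebesgue
measure on the concentric ball of half the radius, as a distribution. -/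
theorem exists_integral_smul_eq_of_gradient_eq_zero [CompleteSpace E] {μ : Measure ℂ} [SFinite μ]
    {h : ℂ → E} (hh : Integrable h μ) {c₀ : ℂ} {R : ℝ} (hR : 0 < R)
    (H : ∀ φ : ℂ → ℝ, ContDiff ℝ ((⊤ : ℕ∞) : WithTop ℕ∞) φ → HasCompactSupport φ →
      tsupport φ ⊆ ball c₀ (2 * R) → ∀ v, ∫ z, fderiv ℝ φ z v • h z ∂μ = 0) :
    ∃ c : E, ∀ φ : ℂ → ℝ, ContDiff ℝ ((⊤ : ℕ∞) : WithTop ℕ∞) φ → HasCompactSupport φ →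
      tsupport φ ⊆ ball c₀ R → ∫ z, φ z • h z ∂μ = (∫ z, φ z) • c := by
  let β : ContDiffBump c₀ := ⟨R / 4, R / 2, by positivity, by linarith⟩
  have hβs : tsupport β ⊆ ball c₀ R := by
    rw [β.tsupport_eq]
    exact closedBall_subset_ball (by change R / 2 < R; linarith)
  -- Average translation invariance of `φ` against `ψ`. The left side is symmetric in `φ` and `ψ`,
  -- so comparison with a fixed bump shows that the functional is a multiple of the integral.
  have main (φ ψ : ℂ → ℝ) (hφ : ContDiff ℝ ((⊤ : ℕ∞) : WithTop ℕ∞) φ) (hcφ : HasCompactSupport φ)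
      (hsφ : tsupport φ ⊆ ball c₀ R) (hψ : ContDiff ℝ ((⊤ : ℕ∞) : WithTop ℕ∞) ψ)
      (hcψ : HasCompactSupport ψ) (hsψ : tsupport ψ ⊆ ball c₀ R) :
      ∫ z, (∫ y, ψ y * φ (z - (y - c₀))) • h z ∂μ = (∫ y, ψ y) • ∫ z, φ z • h z ∂μ := by
    have hint : Integrable (Function.uncurry fun (y z : ℂ) => (ψ y * φ (z - (y - c₀))) • h z)
        ((volume : Measure ℂ).prod μ) := by
      obtain ⟨C, hC⟩ := hcφ.exists_bound_of_continuous hφ.continuous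
      have h1 : Integrable (fun p : ℂ × ℂ => ψ p.1 • h p.2) ((volume : Measure ℂ).prod μ) :=
        (hψ.continuous.integrable_of_hasCompactSupport hcψ).smul_prod hh
      have h2 := h1.bdd_smul (φ := fun p : ℂ × ℂ => φ (p.2 - (p.1 - c₀))) C
        (hφ.continuous.comp (by fun_prop)).aestronglyMeasurable
        (Eventually.of_forall fun p => hC _)
      refine h2.congr (Eventually.of_forall fun p => ?_)
      simp only [Function.uncurry, Pi.smul_apply', smul_smul, mul_comm]
    have h1 := integral_integral_swap hint
    simp_rw [integral_smul_const] at h1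
    rw [← h1, ← integral_smul_const]
    congr 1
    funext y
    by_cases hy : y ∈ tsupport ψ
    · simp_rw [mul_smul]
      rw [integral_smul, integral_translate_eq hh H hφ hcφ hsφ]
      simpa [dist_eq_norm] using hsψ hy
    · simp [image_eq_zero_of_notMem_tsupport hy]
  have hβ0 : 0 < ∫ y, β y := β.integral_pos
  refine ⟨(∫ y, β y)⁻¹ • ∫ z, β z • h z ∂μ, fun φ hφ hcφ hsφ => ?_⟩
  have h1 := main φ β hφ hcφ hsφ β.contDiff β.hasCompactSupport hβs
  have h2 := main β φ β.contDiff β.hasCompactSupport hβs hφ hcφ hsφ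
  -- Symmetry, by the substitution `y ↦ z + c₀ - y`.
  have h3 (z : ℂ) : ∫ y, β y * φ (z - (y - c₀)) = ∫ y, φ y * β (z - (y - c₀)) := by
    rw [← integral_sub_left_eq_self _ volume (z + c₀)]
    congr 1
    funext y
    rw [mul_comm]
    congr 2 <;> ring
  simp_rw [h3] at h1
  rw [h1] at h2
  rw [smul_comm, ← h2, smul_smul, inv_mul_cancel₀ hβ0.ne', one_smul]
end Constancy

/-! ### Mollification in `L²` -/

section Mollification

/-- Convolution with a normed bump function is a contraction of `L²`. -/
theorem eLpNorm_normed_convolution_le (φ : ContDiffBump (0 : ℂ)) {g : ℂ → ℂ}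
    (hg : AEStronglyMeasurable g) :
    eLpNorm (φ.normed volume ⋆[ContinuousLinearMap.lsmul ℝ ℝ, volume] g) 2 volume
      ≤ eLpNorm g 2 volume := by
  wlog hm : StronglyMeasurable g generalizing g
  · have h1 := this hg.stronglyMeasurable_mk.aestronglyMeasurable hg.stronglyMeasurable_mk
    rw [eLpNorm_congr_ae hg.ae_eq_mk]
    rwa [convolution_congr (ContinuousLinearMap.lsmul ℝ ℝ) (EventuallyEq.refl _ _) hg.ae_eq_mk]
  set ρ := φ.normed volume with hρ
  have hρc : Continuous ρ := φ.continuous_normed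
  -- The kernel has mass one, so `L¹ ≤ L²` for the probability measure `ν` bounds the square
  -- pointwise; Tonelli and translation invariance then integrate the bound.
  set ν : Measure ℂ := volume.withDensity fun t => ‖ρ t‖ₑ with hν
  have hνp : IsProbabilityMeasure ν := by
    refine ⟨?_⟩
    rw [hν, withDensity_apply _ MeasurableSet.univ, Measure.restrict_univ]
    have h1 := φ.integral_normed (μ := (volume : Measure ℂ))
    have h2 : ∫⁻ t, ‖ρ t‖ₑ = ENNReal.ofReal (∫ t, ρ t) := by
      rw [ofReal_integral_eq_lintegral_ofReal φ.integrable_normed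
        (Eventually.of_forall φ.nonneg_normed)]
      exact lintegral_congr fun t => Real.enorm_of_nonneg (φ.nonneg_normed t)
    rw [h2, h1, ENNReal.ofReal_one]
  have hpt (x : ℂ) : ‖(ρ ⋆[ContinuousLinearMap.lsmul ℝ ℝ, volume] g) x‖ₑ ^ 2 ≤
      ∫⁻ t, ‖g (x - t)‖ₑ ^ 2 ∂ν := by
    have hmx : AEStronglyMeasurable (fun t => g (x - t)) ν :=
      (hm.comp_measurable (by fun_prop)).aestronglyMeasurable
    have h1 : ‖(ρ ⋆[ContinuousLinearMap.lsmul ℝ ℝ, volume] g) x‖ₑ ≤ ∫⁻ t, ‖g (x - t)‖ₑ ∂ν := by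
      rw [convolution_def]
      refine (enorm_integral_le_lintegral_enorm _).trans_eq ?_
      rw [hν, lintegral_withDensity_eq_lintegral_mul _ (hρc.measurable.enorm)
        (g := fun t => ‖g (x - t)‖ₑ) (hm.comp_measurable (by fun_prop)).enorm]
      refine lintegral_congr fun t => ?_
      rw [ContinuousLinearMap.lsmul_apply, enorm_smul]
      rfl
    have h2 := eLpNorm_le_eLpNorm_of_exponent_le (p := 1) (q := 2) (by norm_num) hmx
    rw [eLpNorm_one_eq_lintegral_enorm] at h2
    calc _ ≤ (eLpNorm (fun t => g (x - t)) 2 ν) ^ 2 := by gcongr; exact h1.trans h2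
      _ = _ := by
        rw [eLpNorm_eq_lintegral_rpow_enorm_toReal (by norm_num) (by norm_num)]
        rw [← ENNReal.rpow_natCast, ← ENNReal.rpow_mul]
        simp
  have h3 : ∫⁻ x, ‖(ρ ⋆[ContinuousLinearMap.lsmul ℝ ℝ, volume] g) x‖ₑ ^ 2 ≤ ∫⁻ x, ‖g x‖ₑ ^ 2 := by
    refine (lintegral_mono hpt).trans_eq ?_
    rw [lintegral_lintegral_swap]
    · have (t : ℂ) : ∫⁻ x, ‖g (x - t)‖ₑ ^ 2 = ∫⁻ x, ‖g x‖ₑ ^ 2 :=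
        lintegral_sub_right_eq_self (fun x => ‖g x‖ₑ ^ 2) t
      simp_rw [this]
      simp
    · exact ((hm.comp_measurable (by fun_prop : Measurable fun p : ℂ × ℂ => p.1 - p.2)).enorm.pow_const
        2).aemeasurable
  rw [eLpNorm_eq_lintegral_rpow_enorm_toReal (by norm_num) (by norm_num),
    eLpNorm_eq_lintegral_rpow_enorm_toReal (by norm_num) (by norm_num)]
  gcongr ?_ ^ _
  simpa using h3

theorem locallyIntegrable_of_memLp_two {g : ℂ → ℂ} (hg : MemLp g 2) : LocallyIntegrable g :=
  hg.locallyIntegrable (by norm_num)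

/-- Uniform continuity gives uniform convergence, and all differences eventually live in one compact
neighbourhood of the support. -/
theorem tendsto_eLpNorm_normed_convolution_of_continuous {φ : ℕ → ContDiffBump (0 : ℂ)}
    (hφ : Tendsto (fun n => (φ n).rOut) atTop (𝓝 0)) {g : ℂ → ℂ} (hg : Continuous g)
    (hc : HasCompactSupport g) :
    Tendsto (fun n => eLpNorm
      (((φ n).normed volume ⋆[ContinuousLinearMap.lsmul ℝ ℝ, volume] g) - g) 2 volume)
      atTop (𝓝 0) := by
  set S : Set ℂ := cthickening 1 (tsupport g) with hS
  have hSc : IsCompact S := hc.isCompact.cthickening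
  rw [ENNReal.tendsto_nhds_zero]
  intro ε hε
  have hA : volume S ^ (2 : ℝ≥0∞).toReal⁻¹ ≠ ∞ :=
    ENNReal.rpow_ne_top_of_nonneg (by positivity) hSc.measure_lt_top.ne
  obtain ⟨δ, hδ, hδ'⟩ : ∃ δ : ℝ, 0 < δ ∧ volume S ^ (2 : ℝ≥0∞).toReal⁻¹ * ENNReal.ofReal δ ≤ ε := by
    have h1 : Tendsto (fun δ : ℝ => volume S ^ (2 : ℝ≥0∞).toReal⁻¹ * ENNReal.ofReal δ) (𝓝 0)
        (𝓝 (volume S ^ (2 : ℝ≥0∞).toReal⁻¹ * ENNReal.ofReal 0)) :=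
      ENNReal.Tendsto.const_mul (ENNReal.tendsto_ofReal tendsto_id) (Or.inr hA)
    rw [ENNReal.ofReal_zero, mul_zero] at h1
    have h2 := (h1.mono_left (nhdsWithin_le_nhds (s := Set.Ioi 0))).eventually_le_const hε
    obtain ⟨δ, h, h'⟩ := (h2.and self_mem_nhdsWithin).exists
    exact ⟨δ, h', h⟩
  obtain ⟨η, hη, hu⟩ := Metric.uniformContinuous_iff.1
    (hc.uniformContinuous_of_continuous hg) δ hδ
  filter_upwards [hφ.eventually_lt_const hη, hφ.eventually_lt_const one_pos] with n hn hn1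
  set F := ((φ n).normed volume ⋆[ContinuousLinearMap.lsmul ℝ ℝ, volume] g) - g with hF
  have hsupp : Function.support F ⊆ S := by
    intro x hx
    by_contra hxS
    apply hx
    have h0 (y : ℂ) (hy : y ∈ ball x (φ n).rOut) : g y = 0 := by
      by_contra hgy
      apply hxS
      refine mem_cthickening_of_dist_le x y 1 _ (subset_tsupport g hgy) ?_
      rw [dist_comm]
      exact (mem_ball.1 hy).le.trans hn1.le
    have h1 := (φ n).normed_convolution_eq_right (μ := volume) (g := g) (x₀ := x)
      fun y hy => by rw [h0 y hy, h0 x (mem_ball_self (φ n).rOut_pos)]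
    rw [hF, Pi.sub_apply, h1, sub_self]
  have hbd (x : ℂ) : ‖F x‖ ≤ δ := by
    rw [hF, Pi.sub_apply, ← dist_eq_norm]
    refine (φ n).dist_normed_convolution_le hg.aestronglyMeasurable fun y hy => ?_
    exact (hu ((mem_ball.1 hy).trans hn)).le
  rw [← eLpNorm_restrict_eq_of_support_subset hsupp]
  refine (eLpNorm_le_of_ae_bound (Eventually.of_forall hbd)).trans ?_
  rwa [Measure.restrict_apply_univ]

/-- Mollifications converge in `L²`. -/
theorem tendsto_eLpNorm_normed_convolution {φ : ℕ → ContDiffBump (0 : ℂ)}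
    (hφ : Tendsto (fun n => (φ n).rOut) atTop (𝓝 0)) {g : ℂ → ℂ} (hg : MemLp g 2) :
    Tendsto (fun n => eLpNorm
      (((φ n).normed volume ⋆[ContinuousLinearMap.lsmul ℝ ℝ, volume] g) - g) 2 volume)
      atTop (𝓝 0) := by
  rw [ENNReal.tendsto_nhds_zero]
  intro ε hε
  have hε3 : ε / 3 ≠ 0 := (ENNReal.div_pos hε.ne' (by norm_num)).ne'
  -- Density of compactly supported continuous functions; the contraction property controls the
  -- mollification of `g - h`.
  obtain ⟨h, hhc, hgh, hh, hhm⟩ := hg.exists_hasCompactSupport_eLpNorm_sub_le (by norm_num) hε3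
  have h1 := (ENNReal.tendsto_nhds_zero.1
    (tendsto_eLpNorm_normed_convolution_of_continuous hφ hh hhc)) (ε / 3) (pos_iff_ne_zero.2 hε3)
  filter_upwards [h1] with n hn
  set ρ := (φ n).normed (volume : Measure ℂ)
  set L := ContinuousLinearMap.lsmul ℝ ℝ (E := ℂ)
  have hex (u : ℂ → ℂ) (hu : MemLp u 2) : ConvolutionExists ρ u L volume :=
    (φ n).hasCompactSupport_normed.convolutionExists_left L (φ n).continuous_normed
      (locallyIntegrable_of_memLp_two hu)
  have hsub : ρ ⋆[L, volume] g = ρ ⋆[L, volume] (g - h) + ρ ⋆[L, volume] h := by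
    rw [← (hex _ (hg.sub hhm)).distrib_add (hex _ hhm), sub_add_cancel]
  have e : ρ ⋆[L, volume] g - g =
      ρ ⋆[L, volume] (g - h) + (ρ ⋆[L, volume] h - h) + (h - g) := by
    rw [hsub]; abel
  have hcont (u : ℂ → ℂ) (hu : MemLp u 2) : Continuous (ρ ⋆[L, volume] u) :=
    (φ n).hasCompactSupport_normed.continuous_convolution_left L (φ n).continuous_normed
      (locallyIntegrable_of_memLp_two hu)
  rw [e]
  have m1 := (hcont _ (hg.sub hhm)).aestronglyMeasurable (μ := volume)
  have m2 := (hcont _ hhm).aestronglyMeasurable (μ := volume)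
  calc _ ≤ eLpNorm (ρ ⋆[L, volume] (g - h) + (ρ ⋆[L, volume] h - h)) 2 volume
        + eLpNorm (h - g) 2 volume :=
        eLpNorm_add_le (m1.add (m2.sub hhm.1)) (hhm.1.sub hg.1) (by norm_num)
    _ ≤ eLpNorm (ρ ⋆[L, volume] (g - h)) 2 volume + eLpNorm (ρ ⋆[L, volume] h - h) 2 volume
        + eLpNorm (h - g) 2 volume := by
        gcongr
        exact eLpNorm_add_le m1 (m2.sub hhm.1) (by norm_num)
    _ ≤ ε / 3 + ε / 3 + ε / 3 := by
        gcongr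
        · exact (eLpNorm_normed_convolution_le (φ n) (hg.sub hhm).1).trans hgh
        · rwa [eLpNorm_sub_comm]
    _ = ε := ENNReal.add_thirds ε
end Mollification

/-! ### Limits of integrals of products -/

section Limits

/-- Split `bₙ Xₙ = bₙ (Xₙ - X) + bₙ X`: the first term is controlled by `L¹` convergence, the second
by dominated convergence. -/
theorem tendsto_integral_mul_of_tendsto_L1 {X : ℂ → ℂ} {Xn : ℕ → ℂ → ℂ} {b : ℂ → ℂ}
    {bn : ℕ → ℂ → ℂ} {C : ℝ} (hX : Integrable X) (hXn : ∀ n, Integrable (Xn n))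
    (hlim : Tendsto (fun n => eLpNorm (Xn n - X) 1 volume) atTop (𝓝 0))
    (hbn : ∀ n, AEStronglyMeasurable (bn n)) (hC : ∀ n z, ‖bn n z‖ ≤ C)
    (hb : ∀ᵐ z, Tendsto (fun n => bn n z) atTop (𝓝 (b z))) :
    Tendsto (fun n => ∫ z, bn n z * Xn n z) atTop (𝓝 (∫ z, b z * X z)) := by
  have h1 : Tendsto (fun n => ∫ z, bn n z * X z) atTop (𝓝 (∫ z, b z * X z)) := by
    refine tendsto_integral_of_dominated_convergence (fun z => C * ‖X z‖)
      (fun n => (hbn n).mul hX.1) (hX.norm.const_mul C) (fun n => Eventually.of_forall fun z => ?_) ?_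
    · rw [norm_mul]
      gcongr
      exact hC n z
    · filter_upwards [hb] with z hz
      exact hz.mul_const _
  have h2 : Tendsto (fun n => ∫ z, bn n z * (Xn n z - X z)) atTop (𝓝 0) := by
    have hlim' : Tendsto (fun n => C * (eLpNorm (Xn n - X) 1 volume).toReal) atTop (𝓝 0) := by
      have := (ENNReal.tendsto_toReal ENNReal.zero_ne_top).comp hlim
      simpa using this.const_mul C
    refine squeeze_zero_norm (fun n => ?_) hlim'
    calc ‖∫ z, bn n z * (Xn n z - X z)‖ ≤ ∫ z, C * ‖Xn n z - X z‖ := by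
          refine norm_integral_le_of_norm_le (((hXn n).sub hX).norm.const_mul C)
            (Eventually.of_forall fun z => ?_)
          rw [norm_mul]
          gcongr
          exact hC n z
      _ = _ := by
          rw [integral_const_mul, eLpNorm_one_eq_lintegral_enorm]
          exact congrArg (C * ·) (integral_norm_eq_lintegral_enorm ((hXn n).sub hX).1)
  have h3 := h2.add h1
  rw [zero_add] at h3
  refine h3.congr fun n => ?_
  have i1 : Integrable (fun z => bn n z * (Xn n z - X z)) :=
    ((hXn n).sub hX).bdd_mul (hbn n) (Eventually.of_forall (hC n))
  have i2 : Integrable (fun z => bn n z * X z) :=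
    hX.bdd_mul (hbn n) (Eventually.of_forall (hC n))
  rw [← integral_add i1 i2]
  congr 1
  funext z
  ring

/-- A bounded bilinear map in the form needed for products of `L²` functions. -/
structure IsBoundedBiadditive (b : ℂ → ℂ → ℂ) (c : NNReal) : Prop where
  sub_left : ∀ x x' y, b (x - x') y = b x y - b x' y
  sub_right : ∀ x y y', b x (y - y') = b x y - b x y'
  bound : ∀ x y, ‖b x y‖₊ ≤ c * ‖x‖₊ * ‖y‖₊
  cont : Continuous (Function.uncurry b)

theorem IsBoundedBiadditive.eLpNorm_le {b : ℂ → ℂ → ℂ} {c : NNReal} (hb : IsBoundedBiadditive b c)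
    {P Q : ℂ → ℂ} (hP : AEStronglyMeasurable P) (hQ : AEStronglyMeasurable Q) :
    eLpNorm (fun z => b (P z) (Q z)) 1 volume ≤ c * eLpNorm P 2 volume * eLpNorm Q 2 volume :=
  eLpNorm_le_eLpNorm_mul_eLpNorm_of_nnnorm hP hQ b c (Eventually.of_forall fun _ => hb.bound _ _)

theorem IsBoundedBiadditive.integrable {b : ℂ → ℂ → ℂ} {c : NNReal} (hb : IsBoundedBiadditive b c)
    {P Q : ℂ → ℂ} (hP : MemLp P 2) (hQ : MemLp Q 2) : Integrable (fun z => b (P z) (Q z)) := by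
  rw [← memLp_one_iff_integrable]
  refine ⟨hb.cont.comp_aestronglyMeasurable (hP.1.prodMk hQ.1), ?_⟩
  refine (hb.eLpNorm_le hP.1 hQ.1).trans_lt ?_
  exact ENNReal.mul_lt_top (ENNReal.mul_lt_top ENNReal.coe_lt_top hP.2) hQ.2

theorem IsBoundedBiadditive.tendsto {b : ℂ → ℂ → ℂ} {c : NNReal} (hb : IsBoundedBiadditive b c)
    {P Q : ℂ → ℂ} {Pn Qn : ℕ → ℂ → ℂ} (hP : MemLp P 2) (hQ : MemLp Q 2)
    (hPn : ∀ n, MemLp (Pn n) 2) (hQn : ∀ n, MemLp (Qn n) 2)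
    (lP : Tendsto (fun n => eLpNorm (Pn n - P) 2 volume) atTop (𝓝 0))
    (lQ : Tendsto (fun n => eLpNorm (Qn n - Q) 2 volume) atTop (𝓝 0)) :
    Tendsto (fun n => eLpNorm ((fun z => b (Pn n z) (Qn n z)) - fun z => b (P z) (Q z)) 1 volume)
      atTop (𝓝 0) := by
  have hlim : Tendsto (fun n => c * eLpNorm (Pn n - P) 2 volume * eLpNorm (Qn n - Q) 2 volume +
      c * eLpNorm P 2 volume * eLpNorm (Qn n - Q) 2 volume +
      c * eLpNorm (Pn n - P) 2 volume * eLpNorm Q 2 volume) atTop (𝓝 0) := by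
    have l1 := ENNReal.Tendsto.const_mul lP (Or.inr (ENNReal.coe_ne_top (r := c)))
    have l2 := ENNReal.Tendsto.mul l1 (Or.inr ENNReal.zero_ne_top) lQ (by simp)
    have l3 := ENNReal.Tendsto.const_mul lQ
      (Or.inr (ENNReal.mul_ne_top (ENNReal.coe_ne_top (r := c)) hP.2.ne))
    have l4 := ENNReal.Tendsto.mul_const l1 (Or.inr hQ.2.ne)
    have := (l2.add l3).add l4
    simpa using this
  refine tendsto_of_tendsto_of_tendsto_of_le_of_le tendsto_const_nhds hlim (fun _ => zero_le)
    fun n => ?_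
  have e : ((fun z => b (Pn n z) (Qn n z)) - fun z => b (P z) (Q z)) =
      (fun z => b ((Pn n - P) z) ((Qn n - Q) z)) + (fun z => b (P z) ((Qn n - Q) z)) +
      fun z => b ((Pn n - P) z) (Q z) := by
    funext z
    simp only [Pi.sub_apply, Pi.add_apply, hb.sub_left, hb.sub_right]
    ring
  have mP := (hPn n).sub hP
  have mQ := (hQn n).sub hQ
  rw [e]
  refine (eLpNorm_add_le ((hb.integrable mP mQ).add (hb.integrable hP mQ)).1
    (hb.integrable mP hQ).1 le_rfl).trans ?_
  gcongr
  · refine (eLpNorm_add_le (hb.integrable mP mQ).1 (hb.integrable hP mQ).1 le_rfl).trans ?_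
    gcongr
    · exact hb.eLpNorm_le mP.1 mQ.1
    · exact hb.eLpNorm_le hP.1 mQ.1
  · exact hb.eLpNorm_le mP.1 hQ.1

/-- At `(fx, fy)` this form is the Jacobian determinant, so `L²` convergence of gradients yields
`L¹` convergence of Jacobians. -/
theorem isBoundedBiadditive_im_conj_mul :
    IsBoundedBiadditive (fun x y => (((conj x * y).im : ℝ) : ℂ)) 1 where
  sub_left x x' y := by rw [map_sub, sub_mul, Complex.sub_im, Complex.ofReal_sub]
  sub_right x y y' := by rw [mul_sub, Complex.sub_im, Complex.ofReal_sub]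
  bound x y := by
    rw [← NNReal.coe_le_coe]
    push_cast
    rw [one_mul, Complex.norm_real]
    refine (Complex.abs_im_le_norm _).trans ?_
    rw [norm_mul, RCLike.norm_conj]
  cont := by unfold Function.uncurry; fun_prop

theorem isBoundedBiadditive_mul_im (e : ℂ) :
    IsBoundedBiadditive (fun x y => x * (((conj e * y).im : ℝ) : ℂ)) ‖e‖₊ where
  sub_left x x' y := by ring
  sub_right x y y' := by rw [mul_sub, Complex.sub_im, Complex.ofReal_sub]; ring
  bound x y := by
    rw [← NNReal.coe_le_coe]
    push_cast
    rw [norm_mul, Complex.norm_real]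
    have h : ‖(conj e * y).im‖ ≤ ‖e‖ * ‖y‖ := by
      refine (Complex.abs_im_le_norm _).trans ?_
      rw [norm_mul, RCLike.norm_conj]
    calc _ ≤ ‖x‖ * (‖e‖ * ‖y‖) := by gcongr
      _ = _ := by ring
  cont := by unfold Function.uncurry; fun_prop
end Limits

/-! ### The Jacobian identity for smooth maps -/

section Smooth

theorem HasCompactSupport.of_eq_zero {α β : Type*} [Zero α] [Zero β] {f : ℂ → α} {g : ℂ → β}
    (hf : HasCompactSupport f) (h : ∀ z, f z = 0 → g z = 0) : HasCompactSupport g :=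
  hf.mono fun z hz hfz => hz (h z hfz)

theorem integral_fderiv_apply_eq_zero {G : ℂ → ℂ} (hG : ContDiff ℝ 1 G) (hc : HasCompactSupport G)
    (v : ℂ) : ∫ z, fderiv ℝ G z v = 0 := by
  have hcd : Continuous (fderiv ℝ G) := hG.continuous_fderiv (by simp)
  have := integral_smul_fderiv_eq_neg_fderiv_smul_of_integrable (μ := volume) (f := fun _ => (1 : ℝ))
    (g := G) (v := v) (by simp) ?_ ?_ (by simp) (fun x _ => hG.differentiable (by simp) x)
  · simpa using this
  · simp only [one_smul]
    exact (hcd.clm_apply continuous_const).integrable_of_hasCompactSupport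
      (hc.fderiv_apply ℝ v)
  · simp only [one_smul]
    exact hG.continuous.integrable_of_hasCompactSupport hc

/-- The Jacobian determinant of a smooth pair integrates to zero if one entry is compactly
supported. -/
theorem integral_jacobian_eq_zero {w : ℂ → ℝ} (hw : ContDiff ℝ 2 w) {β : ℂ → ℂ}
    (hβ : ContDiff ℝ 1 β) (hc : HasCompactSupport β) :
    ∫ z, (fderiv ℝ w z Complex.I • fderiv ℝ β z 1 - fderiv ℝ w z 1 • fderiv ℝ β z Complex.I) = 0 := by
  have hw1 : ContDiff ℝ 1 (fderiv ℝ w) := hw.fderiv_right (by norm_num)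
  have hwv (v : ℂ) : ContDiff ℝ 1 fun z => fderiv ℝ w z v := hw1.clm_apply contDiff_const
  have hd (v u z : ℂ) : fderiv ℝ (fun z => fderiv ℝ w z v • β z) z u =
      fderiv ℝ w z v • fderiv ℝ β z u + (fderiv ℝ (fderiv ℝ w) z u v) • β z := by
    have h1 := ((hw1.differentiable (by simp)) z).hasFDerivAt
    have h2 : HasFDerivAt (fun z => fderiv ℝ w z v) ((fderiv ℝ (fderiv ℝ w) z).flip v) z := by
      have := h1.clm_apply (hasFDerivAt_const v z)
      simpa using this
    have h3 : HasFDerivAt (fun z => fderiv ℝ w z v • β z) _ z :=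
      h2.smul (hβ.differentiable (by simp) z).hasFDerivAt
    rw [h3.fderiv]
    simp
  have hcomp (v : ℂ) : HasCompactSupport fun z => fderiv ℝ w z v • β z :=
    hc.of_eq_zero fun z hz => by rw [hz, smul_zero]
  have hsm (v : ℂ) : ContDiff ℝ 1 fun z => fderiv ℝ w z v • β z := (hwv v).smul hβ
  -- The integrand is the divergence `∂ₓ(w_y β) - ∂_y(wₓ β)`: the mixed second derivatives of `w`
  -- cancel by symmetry.
  have i1 := integral_fderiv_apply_eq_zero (hsm Complex.I) (hcomp _) 1
  have i2 := integral_fderiv_apply_eq_zero (hsm 1) (hcomp _) Complex.I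
  have hint (v u : ℂ) : Integrable fun z => fderiv ℝ (fun z => fderiv ℝ w z v • β z) z u :=
    (((hsm v).continuous_fderiv (by simp)).clm_apply continuous_const).integrable_of_hasCompactSupport
      ((hcomp v).fderiv_apply ℝ u)
  have := integral_sub (hint Complex.I 1) (hint 1 Complex.I)
  rw [i1, i2, sub_zero] at this
  rw [← this]
  congr 1
  funext z
  rw [hd, hd]
  have hsymm : fderiv ℝ (fderiv ℝ w) z 1 Complex.I = fderiv ℝ (fderiv ℝ w) z Complex.I 1 :=
    (hw.contDiffAt.isSymmSndFDerivAt (by simp)).eq _ _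
  rw [hsymm]
  abel

/-- Cramer's rule for expressing `e` in terms of `x` and `y`. -/
theorem im_conj_mul_smul_sub (e x y : ℂ) :
    (conj e * y).im • x - (conj e * x).im • y = (conj x * y).im • e := by
  apply Complex.ext <;> simp <;> ring

/-- Take `w = Im(ē F)` and `β = φ(F) a` in `integral_jacobian_eq_zero`; Cramer's rule collapses the
terms containing the derivative of `φ`. The identity involves only first derivatives of `F`, so it
survives Sobolev limits. -/
theorem smooth_chain_jacobian {F : ℂ → ℂ} (hF : ContDiff ℝ ((⊤ : ℕ∞) : WithTop ℕ∞) F) {φ : ℂ → ℝ}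
    (hφ : ContDiff ℝ ((⊤ : ℕ∞) : WithTop ℕ∞) φ) {a : ℂ → ℂ}
    (ha : ContDiff ℝ ((⊤ : ℕ∞) : WithTop ℕ∞) a) (hc : HasCompactSupport a) (e : ℂ) :
    ∫ z, (fderiv ℝ φ (F z) e • a z) *
        (((conj (fderiv ℝ F z 1) * fderiv ℝ F z Complex.I).im : ℝ) : ℂ) =
      -((∫ z, (φ (F z) : ℂ) * (fderiv ℝ a z 1 * (((conj e * fderiv ℝ F z Complex.I).im : ℝ) : ℂ))) -
        ∫ z, (φ (F z) : ℂ) * (fderiv ℝ a z Complex.I * (((conj e * fderiv ℝ F z 1).im : ℝ) : ℂ))) := by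
  let w : ℂ → ℝ := fun z => (conj e * F z).im
  have hwd (z v : ℂ) : fderiv ℝ w z v = (conj e * fderiv ℝ F z v).im := by
    have h1 : HasFDerivAt w (Complex.imCLM.comp (conj e • fderiv ℝ F z)) z :=
      Complex.imCLM.hasFDerivAt.comp z
        ((hF.differentiable (by simp) z).hasFDerivAt.const_smul (conj e))
    rw [h1.fderiv]
    simp
  have hw : ContDiff ℝ 2 w := by
    have : ContDiff ℝ ((⊤ : ℕ∞) : WithTop ℕ∞) w :=
      Complex.imCLM.contDiff.comp (contDiff_const.mul hF)
    exact contDiff_infty.1 this 2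
  have hb : ContDiff ℝ ((⊤ : ℕ∞) : WithTop ℕ∞) fun z => φ (F z) := hφ.comp hF
  have hbd (z v : ℂ) : fderiv ℝ (fun z => φ (F z) • a z) z v =
      φ (F z) • fderiv ℝ a z v + (fderiv ℝ φ (F z) (fderiv ℝ F z v)) • a z := by
    have h1 := ((hφ.differentiable (by simp) (F z)).hasFDerivAt.comp z
      (hF.differentiable (by simp) z).hasFDerivAt).smul (ha.differentiable (by simp) z).hasFDerivAt
    have h2 : HasFDerivAt (fun z => φ (F z) • a z) _ z := h1
    rw [h2.fderiv]
    simp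
  have key : ∫ z, (fderiv ℝ w z Complex.I • fderiv ℝ (fun z => φ (F z) • a z) z 1 -
      fderiv ℝ w z 1 • fderiv ℝ (fun z => φ (F z) • a z) z Complex.I) = 0 := integral_jacobian_eq_zero hw (contDiff_infty.1 (hb.smul ha) 1)
    (hc.of_eq_zero fun z hz => by rw [hz, smul_zero])
  have cF (v : ℂ) : Continuous fun z => fderiv ℝ F z v :=
    (hF.continuous_fderiv (by simp)).clm_apply continuous_const
  have ca (v : ℂ) : Continuous fun z => fderiv ℝ a z v :=
    (ha.continuous_fderiv (by simp)).clm_apply continuous_const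
  have cφ : Continuous fun z => fderiv ℝ φ (F z) e :=
    ((hφ.continuous_fderiv (by simp)).comp hF.continuous).clm_apply continuous_const
  have hca (v : ℂ) : HasCompactSupport fun z => fderiv ℝ a z v :=
    hc.fderiv_apply ℝ v
  have cF0 := hF.continuous
  have cφ0 := hφ.continuous
  have ca0 := ha.continuous
  have j1 : Integrable fun z => (fderiv ℝ φ (F z) e • a z) *
        (((conj (fderiv ℝ F z 1) * fderiv ℝ F z Complex.I).im : ℝ) : ℂ) := by
    refine Continuous.integrable_of_hasCompactSupport ?_
      (hc.of_eq_zero fun z hz => by rw [hz, smul_zero, zero_mul])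
    have := cF 1
    have := cF Complex.I
    fun_prop
  have j2 (u v : ℂ) : Integrable fun z =>
      (φ (F z) : ℂ) * (fderiv ℝ a z u * (((conj e * fderiv ℝ F z v).im : ℝ) : ℂ)) := by
    refine Continuous.integrable_of_hasCompactSupport ?_
      ((hca u).of_eq_zero fun z hz => by rw [hz, zero_mul, mul_zero])
    have := cF v
    have := ca u
    fun_prop
  have h3 := integral_add j1 ((j2 1 Complex.I).sub (j2 Complex.I 1))
  simp only [Pi.sub_apply] at h3
  rw [eq_neg_iff_add_eq_zero, ← integral_sub (j2 _ _) (j2 _ _), ← h3, ← key]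
  congr 1
  funext z
  simp only [hbd, hwd]
  have := congrArg (fderiv ℝ φ (F z)) (im_conj_mul_smul_sub e (fderiv ℝ F z 1) (fderiv ℝ F z Complex.I))
  simp only [map_sub, map_smul, smul_eq_mul] at this
  have h2 := congrArg (fun r : ℝ => (r : ℂ)) this
  push_cast at h2
  simp only [Complex.real_smul]
  linear_combination (-a z) * h2
end Smooth

/-! ### The Jacobian identity for Sobolev maps of the plane -/

section Global

/-- The derivative falls on the kernel, and `t ↦ ρ (z - t)` is an admissible test function for the
weak derivative. -/
theorem fderiv_mollify {f fv : ℂ → ℂ} {v : ℂ} (hf : LocallyIntegrable f)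
    (hv : HasWeakDirDeriv Set.univ f v fv) (φ : ContDiffBump (0 : ℂ)) (z : ℂ) :
    fderiv ℝ (φ.normed volume ⋆[ContinuousLinearMap.lsmul ℝ ℝ, volume] f) z v =
      (φ.normed volume ⋆[ContinuousLinearMap.lsmul ℝ ℝ, volume] fv) z := by
  set ρ := φ.normed (volume : Measure ℂ) with hρ
  have hρs : ContDiff ℝ ((⊤ : ℕ∞) : WithTop ℕ∞) ρ := φ.contDiff_normed
  have hρc : HasCompactSupport ρ := φ.hasCompactSupport_normed
  have h1 := hρc.hasFDerivAt_convolution_left (ContinuousLinearMap.lsmul ℝ ℝ (E := ℂ))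
    (contDiff_infty.1 hρs 1) hf z
  have hex : ConvolutionExistsAt (fderiv ℝ ρ) f z
      ((ContinuousLinearMap.lsmul ℝ ℝ (E := ℂ)).precompL ℂ) volume :=
    (hρc.fderiv ℝ).convolutionExists_left _ (hρs.continuous_fderiv (by simp)) hf z
  rw [h1.fderiv, convolution_eq_swap, convolution_lsmul_swap]
  rw [ContinuousLinearMap.integral_apply hex.integrable_swap]
  have ht := hv (fun t => ρ (z - t)) (hρs.comp (by fun_prop))
    (hρc.comp_homeomorph (Homeomorph.subLeft z)) (Set.subset_univ _)
  have hd (t : ℂ) : fderiv ℝ (fun t => ρ (z - t)) t v = -fderiv ℝ ρ (z - t) v := by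
    have h2 := (hρs.differentiable (by simp) (z - t)).hasFDerivAt.comp t
      ((hasFDerivAt_id (𝕜 := ℝ) t).const_sub z)
    have h3 : HasFDerivAt (fun t => ρ (z - t)) _ t := h2
    rw [h3.fderiv]
    simp
  simp only [Measure.restrict_univ, hd, neg_smul, integral_neg, neg_inj] at ht
  rw [← ht]
  rfl

theorem memLp_mollify {u : ℂ → ℂ} (hu : MemLp u 2) (φ : ContDiffBump (0 : ℂ)) :
    MemLp (φ.normed volume ⋆[ContinuousLinearMap.lsmul ℝ ℝ, volume] u) 2 := by
  have h : Continuous (φ.normed volume ⋆[ContinuousLinearMap.lsmul ℝ ℝ, volume] u) :=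
    φ.hasCompactSupport_normed.continuous_convolution_left _ φ.continuous_normed
      (locallyIntegrable_of_memLp_two hu)
  exact ⟨h.aestronglyMeasurable, (eLpNorm_normed_convolution_le φ hu.1).trans_lt hu.2⟩

/-- Mollify `f`. Continuity gives pointwise convergence inside `φ`, the gradients converge in `L²`,
and the Jacobians in `L¹`. -/
theorem chain_jacobian_global {f fx fy : ℂ → ℂ} (hf : Continuous f)
    (hx : MemLp fx 2) (hy : MemLp fy 2) (dx : HasWeakDirDeriv Set.univ f 1 fx)
    (dy : HasWeakDirDeriv Set.univ f Complex.I fy) {φ : ℂ → ℝ}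
    (hφ : ContDiff ℝ ((⊤ : ℕ∞) : WithTop ℕ∞) φ) (hφc : HasCompactSupport φ) {a : ℂ → ℂ}
    (ha : ContDiff ℝ ((⊤ : ℕ∞) : WithTop ℕ∞) a) (hac : HasCompactSupport a) (e : ℂ) :
    ∫ z, (fderiv ℝ φ (f z) e • a z) * (((conj (fx z) * fy z).im : ℝ) : ℂ) =
      -((∫ z, (φ (f z) : ℂ) * (fderiv ℝ a z 1 * (((conj e * fy z).im : ℝ) : ℂ))) -
        ∫ z, (φ (f z) : ℂ) * (fderiv ℝ a z Complex.I * (((conj e * fx z).im : ℝ) : ℂ))) := by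
  let β : ℕ → ContDiffBump (0 : ℂ) := fun n =>
    ⟨1 / ((n : ℝ) + 1) / 2, 1 / ((n : ℝ) + 1), by positivity, half_lt_self (by positivity)⟩
  have hβ : Tendsto (fun n => (β n).rOut) atTop (𝓝 0) := tendsto_one_div_add_atTop_nhds_zero_nat
  set L := ContinuousLinearMap.lsmul ℝ ℝ (E := ℂ) with hL
  have hfl : LocallyIntegrable f := hf.locallyIntegrable
  let F : ℕ → ℂ → ℂ := fun n => (β n).normed volume ⋆[L, volume] f
  let P : ℕ → ℂ → ℂ := fun n => (β n).normed volume ⋆[L, volume] fx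
  let Q : ℕ → ℂ → ℂ := fun n => (β n).normed volume ⋆[L, volume] fy
  have hF (n : ℕ) : ContDiff ℝ ((⊤ : ℕ∞) : WithTop ℕ∞) (F n) :=
    (β n).hasCompactSupport_normed.contDiff_convolution_left L (β n).contDiff_normed hfl
  have hFP (n : ℕ) (z : ℂ) : fderiv ℝ (F n) z 1 = P n z := fderiv_mollify hfl dx _ z
  have hFQ (n : ℕ) (z : ℂ) : fderiv ℝ (F n) z Complex.I = Q n z := fderiv_mollify hfl dy _ z
  have hFlim (z : ℂ) : Tendsto (fun n => F n z) atTop (𝓝 (f z)) :=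
    ContDiffBump.convolution_tendsto_right_of_continuous hβ hf z
  have hmem (u : ℂ → ℂ) (hu : MemLp u 2) (n : ℕ) :
      MemLp ((β n).normed volume ⋆[L, volume] u) 2 := memLp_mollify hu (β n)
  have lP : Tendsto (fun n => eLpNorm (P n - fx) 2 volume) atTop (𝓝 0) :=
    tendsto_eLpNorm_normed_convolution hβ hx
  have lQ : Tendsto (fun n => eLpNorm (Q n - fy) 2 volume) atTop (𝓝 0) :=
    tendsto_eLpNorm_normed_convolution hβ hy
  have cφ' : Continuous (fderiv ℝ φ) := hφ.continuous_fderiv (by simp)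
  obtain ⟨C₀, hC₀⟩ := hφc.exists_bound_of_continuous hφ.continuous
  obtain ⟨C₁, hC₁⟩ := (hφc.fderiv ℝ).exists_bound_of_continuous cφ'
  obtain ⟨C₂, hC₂⟩ := hac.exists_bound_of_continuous ha.continuous
  have hC₁0 : 0 ≤ C₁ := (norm_nonneg _).trans (hC₁ 0)
  have l1 : Tendsto (fun n => ∫ z, (fderiv ℝ φ (F n z) e • a z) *
      (((conj (P n z) * Q n z).im : ℝ) : ℂ)) atTop
      (𝓝 (∫ z, (fderiv ℝ φ (f z) e • a z) * (((conj (fx z) * fy z).im : ℝ) : ℂ))) := by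
    refine tendsto_integral_mul_of_tendsto_L1 (C := C₁ * ‖e‖ * C₂)
      (X := fun z => (((conj (fx z) * fy z).im : ℝ) : ℂ))
      (Xn := fun n z => (((conj (P n z) * Q n z).im : ℝ) : ℂ))
      (b := fun z => fderiv ℝ φ (f z) e • a z) (bn := fun n z => fderiv ℝ φ (F n z) e • a z)
      (isBoundedBiadditive_im_conj_mul.integrable hx hy)
      (fun n => isBoundedBiadditive_im_conj_mul.integrable (hmem _ hx n) (hmem _ hy n))
      (isBoundedBiadditive_im_conj_mul.tendsto hx hy (hmem _ hx) (hmem _ hy) lP lQ)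
      (fun n => ?_) (fun n z => ?_) (Eventually.of_forall fun z => ?_)
    · have h1 : Continuous fun z => fderiv ℝ φ (F n z) e :=
        (cφ'.comp (hF n).continuous).clm_apply continuous_const
      exact (h1.smul ha.continuous).aestronglyMeasurable
    · rw [norm_smul]
      gcongr
      · exact (ContinuousLinearMap.le_opNorm _ _).trans (by gcongr; exact hC₁ _)
      · exact hC₂ z
    · have h1 : Tendsto (fun n => fderiv ℝ φ (F n z)) atTop (𝓝 (fderiv ℝ φ (f z))) :=
        (cφ'.tendsto _).comp (hFlim z)
      have h2 : Tendsto (fun n => fderiv ℝ φ (F n z) e) atTop (𝓝 (fderiv ℝ φ (f z) e)) :=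
        ((ContinuousLinearMap.apply ℝ ℝ e).continuous.tendsto _).comp h1
      exact h2.smul_const _
  have l2 (u : ℂ) (G : ℂ → ℂ) (hG : MemLp G 2) :
      Tendsto (fun n => ∫ z, (φ (F n z) : ℂ) * (fderiv ℝ a z u *
        (((conj e * ((β n).normed volume ⋆[L, volume] G) z).im : ℝ) : ℂ))) atTop
      (𝓝 (∫ z, (φ (f z) : ℂ) * (fderiv ℝ a z u * (((conj e * G z).im : ℝ) : ℂ)))) := by
    have hau : MemLp (fun z => fderiv ℝ a z u) 2 :=
      ((ha.continuous_fderiv (by simp)).clm_apply continuous_const).memLp_of_hasCompactSupport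
        (hac.fderiv_apply ℝ u)
    refine tendsto_integral_mul_of_tendsto_L1 (C := C₀)
      (X := fun z => fderiv ℝ a z u * (((conj e * G z).im : ℝ) : ℂ))
      (Xn := fun n z => fderiv ℝ a z u *
        (((conj e * ((β n).normed volume ⋆[L, volume] G) z).im : ℝ) : ℂ))
      (b := fun z => (φ (f z) : ℂ)) (bn := fun n z => (φ (F n z) : ℂ))
      ((isBoundedBiadditive_mul_im e).integrable hau hG)
      (fun n => (isBoundedBiadditive_mul_im e).integrable hau (hmem _ hG n))
      ((isBoundedBiadditive_mul_im e).tendsto hau hG (fun _ => hau) (hmem _ hG) (by simp)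
        (tendsto_eLpNorm_normed_convolution hβ hG))
      (fun n => ?_) (fun n z => ?_) (Eventually.of_forall fun z => ?_)
    · exact (Complex.continuous_ofReal.comp
        (hφ.continuous.comp (hF n).continuous)).aestronglyMeasurable
    · rw [Complex.norm_real]
      exact hC₀ _
    · exact (Complex.continuous_ofReal.tendsto _).comp ((hφ.continuous.tendsto _).comp (hFlim z))
  refine tendsto_nhds_unique l1 ?_
  refine (((l2 1 fy hy).sub (l2 Complex.I fx hx)).neg).congr fun n => ?_
  have := smooth_chain_jacobian (hF n) hφ ha hac e
  simp only [hFP, hFQ] at this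
  exact this.symm
end Global

/-! ### Localization to an open set -/

section Localization

theorem exists_cutoff {S Ω : Set ℂ} (hS : IsCompact S) (hΩ : IsOpen Ω) (h : S ⊆ Ω) :
    ∃ χ : ℂ → ℝ, ContDiff ℝ ((⊤ : ℕ∞) : WithTop ℕ∞) χ ∧ HasCompactSupport χ ∧ tsupport χ ⊆ Ω ∧
      ∀ x ∈ S, ∀ᶠ y in 𝓝 x, χ y = 1 := by
  obtain ⟨T, hT, hST, hTΩ⟩ := exists_compact_between hS hΩ h
  obtain ⟨χ, h1, h0, -⟩ := exists_contMDiffMap_one_nhds_of_subset_interior 𝓘(ℝ, ℂ)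
    (n := (⊤ : ℕ∞)) hS.isClosed hST
  have hts : tsupport χ ⊆ T := by
    refine closure_minimal (fun x hx => ?_) hT.isClosed
    by_contra hxT
    exact hx (h0 x hxT)
  refine ⟨χ, χ.contMDiff.contDiff, hT.of_isClosed_subset (isClosed_tsupport _) hts,
    hts.trans hTΩ, fun x hx => ?_⟩
  exact h1.filter_mono (nhds_le_nhdsSet hx)

theorem memLp_smul_of_tsupport_subset {Ω : Set ℂ} {u : ℂ → ℂ} {θ : ℂ → ℝ} (hθ : Continuous θ)
    (hc : HasCompactSupport θ) (hs : tsupport θ ⊆ Ω) (hu : IsL2Loc Ω u) :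
    MemLp (fun z => θ z • u z) 2 := by
  obtain ⟨C, hC⟩ := hc.exists_bound_of_continuous hθ
  have h1 := hu _ hc.isCompact hs
  have h2 : MemLp (fun z => θ z • u z) 2 (volume.restrict (tsupport θ)) :=
    h1.of_le_mul (c := C) (hθ.aestronglyMeasurable.smul h1.1) (Eventually.of_forall fun z => by
      rw [norm_smul]; gcongr; exact hC z)
  rw [← memLp_indicator_iff_restrict (isClosed_tsupport θ).measurableSet] at h2
  refine h2.ae_eq (Eventually.of_forall fun z => ?_)
  by_cases hz : z ∈ tsupport θ
  · exact Set.indicator_of_mem hz _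
  · simp only [Set.indicator_of_notMem hz, image_eq_zero_of_notMem_tsupport hz, zero_smul]

theorem integrable_smul_of_tsupport_subset {Ω : Set ℂ} {u : ℂ → ℂ} {θ : ℂ → ℝ} (hθ : Continuous θ)
    (hc : HasCompactSupport θ) (hs : tsupport θ ⊆ Ω) (hu : IsL2Loc Ω u) :
    Integrable (fun z => θ z • u z) := by
  have h1 := memLp_smul_of_tsupport_subset hθ hc hs hu
  have h2 : Integrable (fun z => θ z • u z) (volume.restrict (tsupport θ)) := by
    have : IsFiniteMeasure ((volume : Measure ℂ).restrict (tsupport θ)) :=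
      ⟨by rw [Measure.restrict_apply_univ]; exact hc.isCompact.measure_lt_top⟩
    rw [← memLp_one_iff_integrable]
    exact (h1.restrict _).mono_exponent (by norm_num)
  refine (integrableOn_iff_integrable_of_support_subset ?_).1 h2
  intro z hz
  by_contra h
  exact hz (by simp [image_eq_zero_of_notMem_tsupport h])

theorem HasWeakDirDeriv.cutoff {Ω : Set ℂ} {f fv : ℂ → ℂ} {v : ℂ} (hd : HasWeakDirDeriv Ω f v fv)
    (hf : IsL2Loc Ω f) (hfv : IsL2Loc Ω fv) {χ : ℂ → ℝ}
    (hχ : ContDiff ℝ ((⊤ : ℕ∞) : WithTop ℕ∞) χ) (hc : HasCompactSupport χ) (hs : tsupport χ ⊆ Ω) :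
    HasWeakDirDeriv Set.univ (fun z => χ z • f z) v (fun z => χ z • fv z + fderiv ℝ χ z v • f z) := by
  intro φ hφ hφc _
  have key := hd (fun z => φ z * χ z) (hφ.mul hχ) (hc.of_eq_zero fun z hz => by rw [hz, mul_zero])
    ((tsupport_mul_subset_right).trans hs)
  have hfd (z : ℂ) : fderiv ℝ (fun z => φ z * χ z) z v = φ z * fderiv ℝ χ z v + fderiv ℝ φ z v * χ z := by
    have : HasFDerivAt (fun z => φ z * χ z) _ z := (hφ.differentiable (by simp) z).hasFDerivAt.mul
      (hχ.differentiable (by simp) z).hasFDerivAt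
    rw [this.fderiv]
    simp [mul_comm]
  have hset (θ : ℂ → ℝ) (u : ℂ → ℂ) (hθ : ∀ z, χ z = 0 → fderiv ℝ χ z v = 0 → θ z = 0) :
      ∫ z in Ω, θ z • u z = ∫ z, θ z • u z := by
    refine setIntegral_eq_integral_of_forall_compl_eq_zero fun z hz => ?_
    have hz' : z ∉ tsupport χ := fun h => hz (hs h)
    have h1 := image_eq_zero_of_notMem_tsupport hz'
    have h2 : fderiv ℝ χ z v = 0 := by
      rw [fderiv_of_notMem_tsupport ℝ hz']; rfl
    rw [hθ z h1 h2, zero_smul]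
  rw [hset _ _ (fun z h1 h2 => by rw [hfd, h1, h2]; simp), hset _ _ (fun z h1 h2 => by rw [h1]; simp)]
    at key
  have cχ' : Continuous fun z => fderiv ℝ χ z v :=
    (hχ.continuous_fderiv (by simp)).clm_apply continuous_const
  have cφ' : Continuous fun z => fderiv ℝ φ z v :=
    (hφ.continuous_fderiv (by simp)).clm_apply continuous_const
  have cχ := hχ.continuous
  have cφ := hφ.continuous
  have i1 : Integrable fun z => (fderiv ℝ φ z v * χ z) • f z :=
    integrable_smul_of_tsupport_subset (by fun_prop) (hc.of_eq_zero fun z hz => by rw [hz, mul_zero])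
      ((tsupport_mul_subset_right).trans hs) hf
  have i2 : Integrable fun z => (φ z * fderiv ℝ χ z v) • f z :=
    integrable_smul_of_tsupport_subset (by fun_prop)
      ((hc.fderiv_apply ℝ v).of_eq_zero fun z hz => by rw [hz, mul_zero])
      ((tsupport_mul_subset_right).trans ((tsupport_fderiv_apply_subset ℝ v).trans hs)) hf
  have i3 : Integrable fun z => (φ z * χ z) • fv z :=
    integrable_smul_of_tsupport_subset (by fun_prop) (hc.of_eq_zero fun z hz => by rw [hz, mul_zero])
      ((tsupport_mul_subset_right).trans hs) hfv
  simp only [hfd, add_smul] at key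
  rw [integral_add i2 i1] at key
  simp only [Measure.restrict_univ, smul_add, smul_smul]
  rw [integral_add i3 i2]
  linear_combination key

/-- Replace `f` by `χ f` with a cutoff `χ` equal to 1 near the support of `a`; none of the integrals
changes. -/
theorem chain_jacobian {Ω : Set ℂ} (hΩ : IsOpen Ω) {f fx fy : ℂ → ℂ}
    (hf : ContinuousOn f Ω) (hw : HasW12LocPartials Ω f fx fy) {φ : ℂ → ℝ}
    (hφ : ContDiff ℝ ((⊤ : ℕ∞) : WithTop ℕ∞) φ) (hφc : HasCompactSupport φ) {a : ℂ → ℂ}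
    (ha : ContDiff ℝ ((⊤ : ℕ∞) : WithTop ℕ∞) a) (hac : HasCompactSupport a)
    (has : tsupport a ⊆ Ω) (e : ℂ) :
    ∫ z in Ω, (fderiv ℝ φ (f z) e • a z) * (((conj (fx z) * fy z).im : ℝ) : ℂ) =
      -((∫ z in Ω, (φ (f z) : ℂ) * (fderiv ℝ a z 1 * (((conj e * fy z).im : ℝ) : ℂ))) -
        ∫ z in Ω, (φ (f z) : ℂ) * (fderiv ℝ a z Complex.I * (((conj e * fx z).im : ℝ) : ℂ))) := by
  obtain ⟨χ, hχ, hχc, hχs, hχ1⟩ := exists_cutoff hac.isCompact hΩ has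
  have cχ' (v : ℂ) : Continuous fun z => fderiv ℝ χ z v :=
    (hχ.continuous_fderiv (by simp)).clm_apply continuous_const
  have hcont : Continuous fun z => χ z • f z :=
    (hχ.continuous.continuousOn.smul hf).continuous_of_tsupport_subset hΩ
      ((tsupport_smul_subset_left _ _).trans hχs)
  have hL2 (v : ℂ) (fv : ℂ → ℂ) (hfv : IsL2Loc Ω fv) :
      MemLp (fun z => χ z • fv z + fderiv ℝ χ z v • f z) 2 :=
    (memLp_smul_of_tsupport_subset hχ.continuous hχc hχs hfv).add
      (memLp_smul_of_tsupport_subset (cχ' v) (hχc.fderiv_apply ℝ v)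
        ((tsupport_fderiv_apply_subset ℝ v).trans hχs) hw.memL2)
  have key := chain_jacobian_global hcont
    (hL2 1 fx hw.memL2_x) (hL2 Complex.I fy hw.memL2_y)
    (hw.deriv_x.cutoff hw.memL2 hw.memL2_x hχ hχc hχs)
    (hw.deriv_y.cutoff hw.memL2 hw.memL2_y hχ hχc hχs) hφ hφc ha hac e
  have e1 (z : ℂ) (hz : z ∈ tsupport a) : χ z = 1 := (hχ1 z hz).self_of_nhds
  have e2 (z v : ℂ) (hz : z ∈ tsupport a) : fderiv ℝ χ z v = 0 := by
    have : χ =ᶠ[𝓝 z] fun _ => 1 := hχ1 z hz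
    rw [this.fderiv_eq, fderiv_fun_const]
    rfl
  have hset (G G' : ℂ → ℂ) (h0 : ∀ z, z ∉ tsupport a → G z = 0) (h0' : ∀ z, z ∉ tsupport a → G' z = 0)
      (h : ∀ z ∈ tsupport a, G z = G' z) : ∫ z, G z = ∫ z in Ω, G' z := by
    rw [setIntegral_eq_integral_of_forall_compl_eq_zero fun z hz => h0' z fun h => hz (has h)]
    congr 1
    funext z
    by_cases hz : z ∈ tsupport a
    · exact h z hz
    · rw [h0 z hz, h0' z hz]
  have a0 (z : ℂ) (hz : z ∉ tsupport a) : a z = 0 := image_eq_zero_of_notMem_tsupport hz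
  have a1 (z v : ℂ) (hz : z ∉ tsupport a) : fderiv ℝ a z v = 0 := by
    rw [fderiv_of_notMem_tsupport ℝ hz]; rfl
  rw [hset _ (fun z => (fderiv ℝ φ (f z) e • a z) * (((conj (fx z) * fy z).im : ℝ) : ℂ))
      (fun z hz => by rw [a0 z hz, smul_zero, zero_mul])
      (fun z hz => by rw [a0 z hz, smul_zero, zero_mul]) ?_,
    hset _ (fun z => (φ (f z) : ℂ) * (fderiv ℝ a z 1 * (((conj e * fy z).im : ℝ) : ℂ)))
      (fun z hz => by rw [a1 z _ hz, zero_mul, mul_zero])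
      (fun z hz => by rw [a1 z _ hz, zero_mul, mul_zero]) ?_,
    hset _ (fun z => (φ (f z) : ℂ) * (fderiv ℝ a z Complex.I * (((conj e * fx z).im : ℝ) : ℂ)))
      (fun z hz => by rw [a1 z _ hz, zero_mul, mul_zero])
      (fun z hz => by rw [a1 z _ hz, zero_mul, mul_zero]) ?_] at key
  · exact key
  all_goals
    intro z hz
    simp only [e1 z hz, e2 z _ hz, one_smul, zero_smul, add_zero]
end Localization

/-! ### Pulling back test functions by the homeomorphism -/

section TestFunctions

variable (f : OpenPartialHomeomorph ℂ ℂ) {fx fy : ℂ → ℂ}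

theorem isCompact_symm_image {S : Set ℂ} (hS : IsCompact S) (h : S ⊆ f.target) :
    IsCompact (f.symm '' S) ∧ f.symm '' S ⊆ f.source :=
  ⟨hS.image_of_continuousOn (f.continuousOn_symm.mono h), by
    rintro _ ⟨ω, hω, rfl⟩; exact f.map_target (h hω)⟩

/-- Integration by parts against the pullback of a test function on the target. -/
theorem integral_pullback_jacobian (hw : HasW12LocPartials f.source f fx fy) {φ : ℂ → ℝ}
    (hφ : ContDiff ℝ ((⊤ : ℕ∞) : WithTop ℕ∞) φ) (hφc : HasCompactSupport φ)
    (hφs : tsupport φ ⊆ f.target) {l : ℂ → ℂ} (hl : ContDiff ℝ ((⊤ : ℕ∞) : WithTop ℕ∞) l) (e : ℂ) :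
    ∫ z in f.source, (fderiv ℝ φ (f z) e • l z) * (((conj (fx z) * fy z).im : ℝ) : ℂ) =
      -((∫ z in f.source, (φ (f z) : ℂ) * (fderiv ℝ l z 1 * (((conj e * fy z).im : ℝ) : ℂ))) -
        ∫ z in f.source,
          (φ (f z) : ℂ) * (fderiv ℝ l z Complex.I * (((conj e * fx z).im : ℝ) : ℂ))) := by
  -- The homeomorphism property enters here: the preimage of `tsupport φ` is compact in the source,
  -- so `l` can be cut off near it without changing the integrals.
  obtain ⟨hS, hSΩ⟩ := isCompact_symm_image f hφc.isCompact hφs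
  obtain ⟨χ, hχ, hχc, hχs, hχ1⟩ := exists_cutoff hS f.open_source hSΩ
  have key := chain_jacobian f.open_source f.continuousOn hw hφ hφc (hχ.smul hl)
    (hχc.of_eq_zero fun z hz => by rw [Pi.smul_apply', hz, zero_smul])
    ((tsupport_smul_subset_left _ _).trans hχs) e
  have hmem (z : ℂ) (hz : z ∈ f.source) (h : f z ∈ tsupport φ) :
      (χ • l) =ᶠ[𝓝 z] l := by
    filter_upwards [hχ1 z ⟨f z, h, f.left_inv hz⟩] with y hy
    rw [Pi.smul_apply', hy, one_smul]
  have hm := f.open_source.measurableSet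
  have t1 : ∫ z in f.source, (fderiv ℝ φ (f z) e • (χ • l) z) * (((conj (fx z) * fy z).im : ℝ) : ℂ) =
      ∫ z in f.source, (fderiv ℝ φ (f z) e • l z) * (((conj (fx z) * fy z).im : ℝ) : ℂ) := by
    refine setIntegral_congr_fun hm fun z hz => ?_
    by_cases h : f z ∈ tsupport φ
    · simp only [(hmem z hz h).eq_of_nhds]
    · simp only [fderiv_of_notMem_tsupport ℝ h]
      simp
  have t2 (v : ℂ) (G : ℂ → ℂ) : ∫ z in f.source, (φ (f z) : ℂ) * (fderiv ℝ (χ • l) z v * G z) =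
      ∫ z in f.source, (φ (f z) : ℂ) * (fderiv ℝ l z v * G z) := by
    refine setIntegral_congr_fun hm fun z hz => ?_
    by_cases h : f z ∈ tsupport φ
    · simp only [(hmem z hz h).fderiv_eq]
    · simp [image_eq_zero_of_notMem_tsupport h]
  rw [← t1, ← t2, ← t2]
  exact key
end TestFunctions

/-! ### Measures and functions determined by test integrals -/

section MeasureEquality

/-- Two measures on a ball which agree on smooth functions agree on a smaller ball. -/
theorem restrict_ball_eq_of_integral_eq {m m' : Measure ℂ} {c₀ : ℂ} {R r : ℝ} (hr : r < R)
    (hm : m (ball c₀ R) ≠ ∞) (hm' : m' (ball c₀ R) ≠ ∞)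
    (h : ∀ φ : ℂ → ℝ, ContDiff ℝ ((⊤ : ℕ∞) : WithTop ℕ∞) φ → HasCompactSupport φ →
      tsupport φ ⊆ ball c₀ R → ∫ z, φ z ∂m = ∫ z, φ z ∂m') :
    m.restrict (ball c₀ r) = m'.restrict (ball c₀ r) := by
  have hsub : ball c₀ r ⊆ ball c₀ R := ball_subset_ball hr.le
  have hopen (V : Set ℂ) (hV : IsOpen V) : m (V ∩ ball c₀ r) = m' (V ∩ ball c₀ r) := by
    set W := V ∩ ball c₀ r with hW
    have hWo : IsOpen W := hV.inter isOpen_ball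
    have hWR : W ⊆ ball c₀ R := Set.inter_subset_right.trans hsub
    obtain ⟨g, hgs, hg, hgr⟩ := hWo.exists_contDiff_support_eq (n := (⊤ : ℕ∞))
    have hg01 (z : ℂ) : g z ∈ Set.Icc (0 : ℝ) 1 := hgr ⟨z, rfl⟩
    -- Since `g` is positive exactly on `W` with values in `[0, 1]`, these smooth functions increase
    -- to the indicator of `W`.
    let φ : ℕ → ℂ → ℝ := fun n z => 1 - (1 - g z) ^ n
    have hφ (n : ℕ) : ContDiff ℝ ((⊤ : ℕ∞) : WithTop ℕ∞) (φ n) := by fun_prop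
    have hφ0 (n : ℕ) (z : ℂ) (hz : z ∉ W) : φ n z = 0 := by
      rw [← hgs, Function.notMem_support] at hz
      simp [φ, hz]
    have hφs (n : ℕ) : tsupport (φ n) ⊆ closedBall c₀ r := by
      refine closure_minimal (fun z hz => ?_) isClosed_closedBall
      by_contra hzr
      exact hz (hφ0 n z fun h => hzr (ball_subset_closedBall h.2))
    have hφc (n : ℕ) : HasCompactSupport (φ n) :=
      (isCompact_closedBall c₀ r).of_isClosed_subset (isClosed_tsupport _) (hφs n)
    have hφb (n : ℕ) (z : ℂ) : ‖φ n z‖ ≤ W.indicator 1 z := by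
      by_cases hz : z ∈ W
      · have h1 : 0 ≤ (1 - g z) ^ n := pow_nonneg (by linarith [(hg01 z).2]) n
        have h2 : (1 - g z) ^ n ≤ 1 := pow_le_one₀ (by linarith [(hg01 z).2]) (by linarith [(hg01 z).1])
        rw [Set.indicator_of_mem hz, Real.norm_eq_abs, abs_le, Pi.one_apply]
        constructor <;> simp only [φ] <;> linarith
      · rw [hφ0 n z hz, Set.indicator_of_notMem hz, norm_zero]
    have hlim (z : ℂ) : Tendsto (fun n => φ n z) atTop (𝓝 (W.indicator 1 z)) := by
      by_cases hz : z ∈ W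
      · have hz' : g z ≠ 0 := by rwa [← hgs] at hz
        have h0 : 0 < g z := lt_of_le_of_ne (hg01 z).1 hz'.symm
        have := (tendsto_pow_atTop_nhds_zero_of_lt_one (r := 1 - g z) (by linarith [(hg01 z).2])
          (by linarith)).const_sub 1
        rw [Set.indicator_of_mem hz]
        simpa using this
      · simp only [hφ0 _ z hz, Set.indicator_of_notMem hz]
        exact tendsto_const_nhds
    have hint (M : Measure ℂ) (hM : M (ball c₀ R) ≠ ∞) :
        Tendsto (fun n => ∫ z, φ n z ∂M) atTop (𝓝 (M W).toReal) := by
      have hMW : M W ≠ ∞ := ne_top_of_le_ne_top hM (measure_mono hWR)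
      have h1 := tendsto_integral_of_dominated_convergence (μ := M) (W.indicator (1 : ℂ → ℝ))
        (F := φ) (f := W.indicator (1 : ℂ → ℝ))
        (fun n => (hφ n).continuous.aestronglyMeasurable)
        ((integrable_indicator_iff hWo.measurableSet).2
          (integrableOn_const (μ := M) (C := (1 : ℝ)) hMW))
        (fun n => Eventually.of_forall (hφb n)) (Eventually.of_forall hlim)
      rwa [integral_indicator_one hWo.measurableSet] at h1
    have h1 := hint m hm
    have h2 := hint m' hm'
    simp only [h _ (hφ _) (hφc _) ((hφs _).trans (closedBall_subset_ball hr))] at h1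
    have h3 := tendsto_nhds_unique h1 h2
    exact (ENNReal.toReal_eq_toReal_iff' (ne_top_of_le_ne_top hm (measure_mono hWR))
      (ne_top_of_le_ne_top hm' (measure_mono hWR))).1 h3
  have : IsFiniteMeasure (m.restrict (ball c₀ r)) :=
    ⟨by rw [Measure.restrict_apply_univ]; exact (measure_mono hsub).trans_lt hm.lt_top⟩
  refine ext_of_generate_finite {s : Set ℂ | IsOpen s} (BorelSpace.measurable_eq) isPiSystem_isOpen
    (fun s hs => ?_) ?_
  · have hs' : MeasurableSet s := (show IsOpen s from hs).measurableSet
    rw [Measure.restrict_apply hs', Measure.restrict_apply hs']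
    exact hopen s hs
  · rw [Measure.restrict_apply MeasurableSet.univ, Measure.restrict_apply MeasurableSet.univ]
    exact hopen _ isOpen_univ

end MeasureEquality

section Constant

/-- A continuous function with vanishing weak gradient is constant almost everywhere on small
balls. -/
theorem exists_ae_eq_const_of_gradient_eq_zero {u : ℂ → ℂ} {c₀ : ℂ} {R : ℝ} (hR : 0 < R)
    (hu : ContinuousOn u (closedBall c₀ (2 * R)))
    (h1 : ∀ φ : ℂ → ℝ, ContDiff ℝ ((⊤ : ℕ∞) : WithTop ℕ∞) φ → HasCompactSupport φ →
      tsupport φ ⊆ ball c₀ (2 * R) → ∀ v, ∫ z, fderiv ℝ φ z v • u z = 0) :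
    ∃ c, ∀ᵐ z, z ∈ ball c₀ R → u z = c := by
  have hint : IntegrableOn u (closedBall c₀ (2 * R)) :=
    hu.integrableOn_compact (isCompact_closedBall _ _)
  have hset (θ : ℂ → ℝ) (hθ : tsupport θ ⊆ ball c₀ (2 * R)) :
      ∫ z in closedBall c₀ (2 * R), θ z • u z = ∫ z, θ z • u z := by
    refine setIntegral_eq_integral_of_forall_compl_eq_zero fun z hz => ?_
    rw [image_eq_zero_of_notMem_tsupport fun h => hz (ball_subset_closedBall (hθ h)), zero_smul]
  obtain ⟨c, hc⟩ := exists_integral_smul_eq_of_gradient_eq_zero hint hR fun φ hφ hφc hφs v => by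
    rw [hset _ ((tsupport_fderiv_apply_subset ℝ v).trans hφs)]
    exact h1 φ hφ hφc hφs v
  have hRR : ball c₀ R ⊆ ball c₀ (2 * R) := ball_subset_ball (by linarith)
  have hRR' : ball c₀ R ⊆ closedBall c₀ (2 * R) := hRR.trans ball_subset_closedBall
  refine ⟨c, ?_⟩
  have := isOpen_ball.ae_eq_zero_of_integral_contDiff_smul_eq_zero (μ := volume) (U := ball c₀ R)
    (f := fun z => u z - c) ?_ ?_
  · filter_upwards [this] with z hz hzb
    exact sub_eq_zero.1 (hz hzb)
  · exact (((hu.mono hRR').sub continuousOn_const).locallyIntegrableOn measurableSet_ball)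
  · intro φ hφ hφc hφs
    have h2 := hc φ hφ hφc hφs
    rw [hset _ (hφs.trans hRR)] at h2
    have i1 : Integrable fun z => φ z • u z := by
      refine Continuous.integrable_of_hasCompactSupport ?_
        (hφc.of_eq_zero fun z hz => by rw [hz, zero_smul])
      exact (hφ.continuous.continuousOn.smul (hu.mono hRR')).continuous_of_tsupport_subset
        isOpen_ball ((tsupport_smul_subset_left _ _).trans hφs)
    have i2 : Integrable fun z => φ z • c :=
      (hφ.continuous.integrable_of_hasCompactSupport hφc).smul_const c
    simp only [smul_sub]
    rw [integral_sub i1 i2, h2, integral_smul_const, sub_self]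
end Constant

/-! ### The push-forward of the Jacobian measure -/

/-- The Jacobian determinant of a map with partial derivatives `fx`, `fy`. -/
noncomputable def jac (fx fy : ℂ → ℂ) (z : ℂ) : ℝ := (conj (fx z) * fy z).im

/-- The measure on the source of `f` with density the Jacobian determinant of `f`. -/
noncomputable def jacMeasure (f : OpenPartialHomeomorph ℂ ℂ) (fx fy : ℂ → ℂ) : Measure ℂ :=
  (volume.restrict f.source).withDensity fun z => ENNReal.ofReal (jac fx fy z)

section
variable {f : OpenPartialHomeomorph ℂ ℂ} {fx fy : ℂ → ℂ}

theorem IsL2Loc.aestronglyMeasurable {U : Set ℂ} (hU : IsOpen U) {u : ℂ → ℂ} (hu : IsL2Loc U u) :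
    AEStronglyMeasurable u (volume.restrict U) := by
  refine LocallyIntegrableOn.aestronglyMeasurable ((locallyIntegrableOn_iff hU.isLocallyClosed).2
    fun k hk hkc => ?_)
  have : IsFiniteMeasure ((volume : Measure ℂ).restrict k) :=
    ⟨by rw [Measure.restrict_apply_univ]; exact hkc.measure_lt_top⟩
  exact memLp_one_iff_integrable.1 ((hu k hkc hk).mono_exponent (by norm_num))

theorem OpenPartialHomeomorph.aemeasurable_restrict_source (f : OpenPartialHomeomorph ℂ ℂ) :
    AEMeasurable f (volume.restrict f.source) :=
  f.continuousOn.aemeasurable f.open_source.measurableSet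

theorem aemeasurable_jac (hw : HasW12LocPartials f.source f fx fy) :
    AEMeasurable (jac fx fy) (volume.restrict f.source) := by
  have h1 := (hw.memL2_x.aestronglyMeasurable f.open_source).aemeasurable
  have h2 := (hw.memL2_y.aestronglyMeasurable f.open_source).aemeasurable
  exact Complex.measurable_im.comp_aemeasurable
    ((Complex.continuous_conj.measurable.comp_aemeasurable h1).mul h2)

theorem jacMeasure_absolutelyContinuous : jacMeasure f fx fy ≪ volume.restrict f.source :=
  withDensity_absolutelyContinuous _ _

theorem aemeasurable_jacMeasure : AEMeasurable f (jacMeasure f fx fy) :=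
  f.aemeasurable_restrict_source.mono_ac jacMeasure_absolutelyContinuous

instance : SFinite (jacMeasure f fx fy) := by unfold jacMeasure; infer_instance

theorem integrableOn_jac (hw : HasW12LocPartials f.source f fx fy) {S : Set ℂ} (hS : IsCompact S)
    (h : S ⊆ f.source) : IntegrableOn (jac fx fy) S := by
  have h1 := hw.memL2_x S hS h
  have h2 := hw.memL2_y S hS h
  refine (h1.norm.integrable_mul h2.norm).mono
    ((aemeasurable_jac hw).mono_measure (Measure.restrict_mono h le_rfl)).aestronglyMeasurable
    (Eventually.of_forall fun z => ?_)
  rw [Pi.mul_apply, norm_mul, norm_norm, norm_norm, ← RCLike.norm_conj (fx z), ← norm_mul]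
  exact Complex.abs_im_le_norm _

theorem map_jacMeasure_lt_top (hw : HasW12LocPartials f.source f fx fy) {S : Set ℂ}
    (hS : IsCompact S) (h : S ⊆ f.target) : (jacMeasure f fx fy).map f S < ∞ := by
  obtain ⟨hS', hS's⟩ := isCompact_symm_image f hS h
  rw [Measure.map_apply_of_aemeasurable aemeasurable_jacMeasure hS.measurableSet, jacMeasure,
    withDensity_apply', Measure.restrict_restrict' f.open_source.measurableSet]
  have hsub : f ⁻¹' S ∩ f.source ⊆ f.symm '' S := fun z hz => ⟨f z, hz.1, f.left_inv hz.2⟩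
  refine (lintegral_mono_set hsub).trans_lt ?_
  refine (lintegral_mono fun z => ?_).trans_lt (integrableOn_jac hw hS' hS's).2
  rw [← ofReal_norm]
  exact ENNReal.ofReal_le_ofReal (le_abs_self _)

theorem integral_map_jacMeasure {E : Type*} [NormedAddCommGroup E] [NormedSpace ℝ E]
    (hw : HasW12LocPartials f.source f fx fy)
    (hJ : ∀ᵐ z ∂volume.restrict f.source, 0 ≤ jac fx fy z) {G : ℂ → E}
    (hG : AEStronglyMeasurable G ((jacMeasure f fx fy).map f)) :
    ∫ ω, G ω ∂(jacMeasure f fx fy).map f = ∫ z in f.source, jac fx fy z • G (f z) := by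
  rw [integral_map aemeasurable_jacMeasure hG, jacMeasure,
    integral_withDensity_eq_integral_toReal_smul₀ (aemeasurable_jac hw).ennreal_ofReal
      (Eventually.of_forall fun _ => ENNReal.ofReal_lt_top)]
  refine integral_congr_ae ?_
  filter_upwards [hJ] with z hz
  simp only [ENNReal.toReal_ofReal hz]

/-- With `l = 1` in `integral_pullback_jacobian`, both terms on the right contain a derivative of a
constant. -/
theorem integral_fderiv_map_jacMeasure (hw : HasW12LocPartials f.source f fx fy)
    (hJ : ∀ᵐ z ∂volume.restrict f.source, 0 ≤ jac fx fy z) {φ : ℂ → ℝ}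
    (hφ : ContDiff ℝ ((⊤ : ℕ∞) : WithTop ℕ∞) φ) (hφc : HasCompactSupport φ)
    (hφs : tsupport φ ⊆ f.target) (e : ℂ) :
    ∫ ω, fderiv ℝ φ ω e ∂(jacMeasure f fx fy).map f = 0 := by
  have hc : Continuous fun ω => fderiv ℝ φ ω e :=
    (hφ.continuous_fderiv (by simp)).clm_apply continuous_const
  have key := integral_pullback_jacobian f hw hφ hφc hφs (l := fun _ => 1) contDiff_const e
  simp only [fderiv_fun_const, Pi.zero_apply] at key
  have h0 (v : ℂ) : (0 : ℂ →L[ℝ] ℂ) v = 0 := rfl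
  simp only [h0, zero_mul, mul_zero, integral_zero, sub_zero, neg_zero] at key
  rw [integral_map_jacMeasure hw hJ hc.aestronglyMeasurable]
  rw [← Complex.ofReal_eq_zero, ← integral_complex_ofReal, ← key]
  congr 1
  funext z
  simp [jac, mul_comm]

/-- A Sobolev homeomorphism cannot have vanishing partial derivatives on an open set. -/
theorem false_of_partials_eq_zero (hw : HasW12LocPartials f.source f fx fy) {V : Set ℂ}
    (hV : IsOpen V) (hne : V.Nonempty) (hVs : V ⊆ f.source)
    (h0 : ∀ᵐ z ∂volume.restrict V, fx z = 0 ∧ fy z = 0) : False := by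
  obtain ⟨z₀, hz₀⟩ := hne
  obtain ⟨ε, hε, hεV⟩ := nhds_basis_closedBall.mem_iff.1 (hV.mem_nhds hz₀)
  have hR : 0 < ε / 2 := by positivity
  have h2 : 2 * (ε / 2) = ε := by ring
  have hset (θ : ℂ → ℝ) (u : ℂ → ℂ) (hθ : tsupport θ ⊆ V) (W : Set ℂ) (hVW : V ⊆ W) :
      ∫ z in W, θ z • u z = ∫ z, θ z • u z := by
    refine setIntegral_eq_integral_of_forall_compl_eq_zero fun z hz => ?_
    rw [image_eq_zero_of_notMem_tsupport fun h => hz (hVW (hθ h)), zero_smul]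
  have hd (v : ℂ) (fv : ℂ → ℂ) (hfv : HasWeakDirDeriv f.source f v fv)
      (hv0 : ∀ᵐ z ∂volume.restrict V, fv z = 0) (φ : ℂ → ℝ)
      (hφ : ContDiff ℝ ((⊤ : ℕ∞) : WithTop ℕ∞) φ) (hφc : HasCompactSupport φ)
      (hφs : tsupport φ ⊆ V) : ∫ z, fderiv ℝ φ z v • f z = 0 := by
    have h1 := hfv φ hφ hφc (hφs.trans hVs)
    rw [hset _ _ hφs _ hVs, hset _ _ ((tsupport_fderiv_apply_subset ℝ v).trans hφs) _ hVs,
      ← hset φ fv hφs V le_rfl] at h1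
    rw [h1, neg_eq_zero]
    refine integral_eq_zero_of_ae ?_
    filter_upwards [hv0] with z hz
    simp [hz]
  obtain ⟨c, hc⟩ := exists_ae_eq_const_of_gradient_eq_zero (u := f) (c₀ := z₀) hR
    (by rw [h2]; exact f.continuousOn.mono (hεV.trans hVs)) fun φ hφ hφc hφs v => by
      rw [h2] at hφs
      have hφV := hφs.trans (ball_subset_closedBall.trans hεV)
      have e1 := hd 1 fx hw.deriv_x (h0.mono fun _ h => h.1) φ hφ hφc hφV
      have e2 := hd Complex.I fy hw.deriv_y (h0.mono fun _ h => h.2) φ hφ hφc hφV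
      have hi (u : ℂ) : Integrable fun z => fderiv ℝ φ z u • f z :=
        integrable_smul_of_tsupport_subset (Ω := f.source)
          ((hφ.continuous_fderiv (by simp)).clm_apply continuous_const) (hφc.fderiv_apply ℝ u)
          ((tsupport_fderiv_apply_subset ℝ u).trans (hφV.trans hVs)) hw.memL2
      have hv (z : ℂ) : fderiv ℝ φ z v • f z =
          v.re • (fderiv ℝ φ z 1 • f z) + v.im • (fderiv ℝ φ z Complex.I • f z) := by
        have : v = v.re • (1 : ℂ) + v.im • Complex.I := by
          apply Complex.ext <;> simp
        conv_lhs => rw [this]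
        rw [map_add, map_smul, map_smul, add_smul, smul_assoc, smul_assoc]
      simp only [hv]
      rw [integral_add ((hi 1).fun_smul _) ((hi Complex.I).fun_smul _), integral_smul, integral_smul, e1, e2]
      simp
  -- `f` equals `c` almost everywhere on the ball, yet injectivity leaves at most one such point.
  have hinj : Set.Subsingleton {z | z ∈ ball z₀ (ε / 2) ∧ f z = c} := by
    have hbs : ball z₀ (ε / 2) ⊆ f.source :=
      (ball_subset_closedBall.trans (closedBall_subset_closedBall (by linarith))).trans
        (hεV.trans hVs)
    intro x hx y hy
    exact f.injOn (hbs hx.1) (hbs hy.1) (hx.2.trans hy.2.symm)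
  have hnull : volume {z | z ∈ ball z₀ (ε / 2) ∧ f z = c} = 0 := hinj.measure_zero _
  have hall : ∀ᵐ z, z ∉ ball z₀ (ε / 2) := by
    have hn : ∀ᵐ z, z ∉ {z | z ∈ ball z₀ (ε / 2) ∧ f z = c} := measure_eq_zero_iff_ae_notMem.1 hnull
    filter_upwards [hc, hn] with z h1 h2 hz
    exact h2 ⟨hz, h1 hz⟩
  have := measure_eq_zero_iff_ae_notMem.2 hall
  exact (measure_ball_pos volume z₀ hR).ne' this

/-- The push-forward has zero gradient, hence is a constant multiple of Lebesgue measure near `ω₀`.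
If the constant were 0, `J` would vanish a.e. on an open set, and by the distortion inequality so
would `Df`. -/
theorem exists_local_density (hw : HasW12LocPartials f.source f fx fy) {C : ℝ}
    (hdist : ∀ᵐ z ∂volume.restrict f.source, ‖fx z‖ ^ 2 + ‖fy z‖ ^ 2 ≤ C * jac fx fy z)
    (hJ : ∀ᵐ z ∂volume.restrict f.source, 0 ≤ jac fx fy z) {ω₀ : ℂ} (hω₀ : ω₀ ∈ f.target) :
    ∃ r > 0, ∃ c : NNReal, 0 < c ∧ ball ω₀ r ⊆ f.target ∧
      ((jacMeasure f fx fy).map f).restrict (ball ω₀ r) = c • volume.restrict (ball ω₀ r) := by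
  set μ := (jacMeasure f fx fy).map f with hμ
  obtain ⟨ε, hε, hεU⟩ := nhds_basis_closedBall.mem_iff.1 (f.open_target.mem_nhds hω₀)
  set R := ε / 2 with hR
  have hR0 : 0 < R := by positivity
  have h2R : 2 * R = ε := by rw [hR]; ring
  have hfin : μ (closedBall ω₀ ε) < ∞ := map_jacMeasure_lt_top hw (isCompact_closedBall _ _) hεU
  have : IsFiniteMeasure (μ.restrict (closedBall ω₀ ε)) :=
    ⟨by rwa [Measure.restrict_apply_univ]⟩
  have hset (θ : ℂ → ℝ) (hθ : tsupport θ ⊆ ball ω₀ ε) :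
      ∫ z in closedBall ω₀ ε, θ z ∂μ = ∫ z, θ z ∂μ := by
    refine setIntegral_eq_integral_of_forall_compl_eq_zero fun z hz => ?_
    rw [image_eq_zero_of_notMem_tsupport fun h => hz (ball_subset_closedBall (hθ h))]
  obtain ⟨c, hc⟩ := exists_integral_smul_eq_of_gradient_eq_zero (c₀ := ω₀) (R := R)
    (μ := μ.restrict (closedBall ω₀ ε)) (h := fun _ => (1 : ℝ)) (integrable_const _) hR0
    fun φ hφ hφc hφs v => by
      rw [h2R] at hφs
      simp only [smul_eq_mul, mul_one]
      rw [hset _ ((tsupport_fderiv_apply_subset ℝ v).trans hφs)]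
      exact integral_fderiv_map_jacMeasure hw hJ hφ hφc
        (hφs.trans (ball_subset_closedBall.trans hεU)) v
  have hRε : ball ω₀ R ⊆ ball ω₀ ε := ball_subset_ball (by linarith)
  have hc' (φ : ℂ → ℝ) (hφ : ContDiff ℝ ((⊤ : ℕ∞) : WithTop ℕ∞) φ) (hφc : HasCompactSupport φ)
      (hφs : tsupport φ ⊆ ball ω₀ R) : ∫ z, φ z ∂μ = (∫ z, φ z) * c := by
    have := hc φ hφ hφc hφs
    simp only [smul_eq_mul, mul_one] at this
    rwa [hset _ (hφs.trans hRε)] at this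
  have hc0 : 0 ≤ c := by
    let β : ContDiffBump ω₀ := ⟨R / 4, R / 2, by positivity, by linarith⟩
    have h1 := hc' β β.contDiff β.hasCompactSupport (by
      rw [β.tsupport_eq]; exact closedBall_subset_ball (by change R / 2 < R; linarith))
    have h2 : 0 < ∫ z, β z := β.integral_pos
    have h3 : 0 ≤ ∫ z, β z ∂μ := integral_nonneg fun z => β.nonneg
    by_contra! h4
    nlinarith
  have hball : ball ω₀ (R / 2) ⊆ f.target :=
    (ball_subset_ball (by linarith)).trans (hRε.trans (ball_subset_closedBall.trans hεU))
  have heq : μ.restrict (ball ω₀ (R / 2)) = c.toNNReal • volume.restrict (ball ω₀ (R / 2)) := by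
    rw [← Measure.restrict_smul]
    refine restrict_ball_eq_of_integral_eq (R := R) (by linarith)
      (ne_top_of_le_ne_top hfin.ne (measure_mono (hRε.trans ball_subset_closedBall))) ?_
      fun φ hφ hφc hφs => ?_
    · rw [Measure.smul_apply]
      exact ENNReal.mul_ne_top ENNReal.coe_ne_top measure_ball_lt_top.ne
    · rw [hc' φ hφ hφc hφs, integral_smul_nnreal_measure, NNReal.smul_def, Real.coe_toNNReal _ hc0,
        smul_eq_mul, mul_comm]
  refine ⟨R / 2, by positivity, c.toNNReal, ?_, hball, heq⟩
  rw [pos_iff_ne_zero]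
  intro hzero
  rw [hzero, zero_smul, Measure.restrict_eq_zero, hμ,
    Measure.map_apply_of_aemeasurable aemeasurable_jacMeasure measurableSet_ball, jacMeasure,
    withDensity_apply', Measure.restrict_restrict' f.open_source.measurableSet] at heq
  set V := f ⁻¹' ball ω₀ (R / 2) ∩ f.source with hV
  have hVo : IsOpen V := by
    rw [hV, Set.inter_comm]
    exact f.isOpen_inter_preimage isOpen_ball
  have hVs : V ⊆ f.source := Set.inter_subset_right
  have hle : volume.restrict V ≤ volume.restrict f.source := Measure.restrict_mono hVs le_rfl
  rw [lintegral_eq_zero_iff' ((aemeasurable_jac hw).mono_measure hle).ennreal_ofReal] at heq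
  refine false_of_partials_eq_zero hw hVo ⟨f.symm ω₀, ?_, f.map_target hω₀⟩ hVs ?_
  · rw [Set.mem_preimage, f.right_inv hω₀]
    exact mem_ball_self (by positivity)
  · filter_upwards [heq, ae_mono hle hdist, ae_mono hle hJ] with z h1 h2 h3
    have h4 : jac fx fy z = 0 := le_antisymm (ENNReal.ofReal_eq_zero.1 h1) h3
    rw [h4, mul_zero] at h2
    constructor
    · have : ‖fx z‖ ^ 2 = 0 := by nlinarith [sq_nonneg ‖fx z‖, sq_nonneg ‖fy z‖]
      simpa using this
    · have : ‖fy z‖ ^ 2 = 0 := by nlinarith [sq_nonneg ‖fx z‖, sq_nonneg ‖fy z‖]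
      simpa using this
end

section
variable {f : OpenPartialHomeomorph ℂ ℂ} {fx fy : ℂ → ℂ}

theorem map_jacMeasure_restrict_target :
    ((jacMeasure f fx fy).map f).restrict f.target = (jacMeasure f fx fy).map f := by
  refine Measure.restrict_eq_self_of_ae_mem ?_
  refine (ae_map_iff aemeasurable_jacMeasure f.open_target.measurableSet).2 ?_
  refine jacMeasure_absolutelyContinuous.ae_le ?_
  filter_upwards [ae_restrict_mem f.open_source.measurableSet] with z hz
  exact f.map_source hz

/-- The image of the Jacobian measure is Lebesgue measure on the target, up to a locally constant
positive factor. -/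
theorem exists_density (hw : HasW12LocPartials f.source f fx fy) {C : ℝ}
    (hdist : ∀ᵐ z ∂volume.restrict f.source, ‖fx z‖ ^ 2 + ‖fy z‖ ^ 2 ≤ C * jac fx fy z)
    (hJ : ∀ᵐ z ∂volume.restrict f.source, 0 ≤ jac fx fy z) :
    ∃ c : ℂ → NNReal, (∀ ω ∈ f.target, 0 < c ω) ∧
      (∀ ω ∈ f.target, ∀ᶠ ω' in 𝓝 ω, c ω' = c ω) ∧
      (jacMeasure f fx fy).map f = (volume.restrict f.target).withDensity fun ω => c ω := by
  set μ := (jacMeasure f fx fy).map f with hμ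
  have hex (ω : ℂ) : ∃ r : ℝ, ∃ c : NNReal, ω ∈ f.target → 0 < r ∧ 0 < c ∧
      ball ω r ⊆ f.target ∧ μ.restrict (ball ω r) = c • volume.restrict (ball ω r) := by
    by_cases hω : ω ∈ f.target
    · obtain ⟨r, hr, c, h⟩ := exists_local_density hw hdist hJ hω
      exact ⟨r, c, fun _ => ⟨hr, h⟩⟩
    · exact ⟨0, 0, fun h => absurd h hω⟩
  choose r c hrc using hex
  have hball (ω : ℂ) (hω : ω ∈ f.target) (s : Set ℂ) (hs : MeasurableSet s) (hsb : s ⊆ ball ω (r ω)) :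
      μ s = c ω * volume s := by
    have h1 := congrArg (fun m : Measure ℂ => m s) (hrc ω hω).2.2.2
    simp only [Measure.smul_apply, Measure.restrict_apply hs, Set.inter_eq_left.2 hsb] at h1
    exact h1
  -- Two overlapping balls share an open set of positive finite Lebesgue measure, on which both
  -- factors describe `μ`.
  have hconst (ω : ℂ) (hω : ω ∈ f.target) (ω' : ℂ) (hω' : ω' ∈ ball ω (r ω)) : c ω' = c ω := by
    have hω't := (hrc ω hω).2.2.1 hω'
    set s := ball ω (r ω) ∩ ball ω' (r ω') with hs
    have hso : IsOpen s := isOpen_ball.inter isOpen_ball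
    have hpos : 0 < volume s := hso.measure_pos volume ⟨ω', hω', mem_ball_self (hrc ω' hω't).1⟩
    have hfin : volume s ≠ ∞ := ne_top_of_le_ne_top measure_ball_lt_top.ne
      (measure_mono Set.inter_subset_left)
    have h1 := hball ω hω s hso.measurableSet Set.inter_subset_left
    have h2 := hball ω' hω't s hso.measurableSet Set.inter_subset_right
    rw [h1, ENNReal.mul_left_inj hpos.ne' hfin] at h2
    exact_mod_cast h2.symm
  refine ⟨c, fun ω hω => (hrc ω hω).2.1, fun ω hω => ?_, ?_⟩
  · filter_upwards [ball_mem_nhds ω (hrc ω hω).1] with ω' hω'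
    exact hconst ω hω ω' hω'
  · obtain ⟨T, hTs, hTc, hTU⟩ := TopologicalSpace.countable_cover_nhdsWithin (s := f.target)
      (f := fun ω => ball ω (r ω)) fun ω hω => mem_nhdsWithin_of_mem_nhds
        (ball_mem_nhds ω (hrc ω hω).1)
    have hU : f.target = ⋃ ω ∈ T, ball ω (r ω) :=
      hTU.antisymm (Set.iUnion₂_subset fun ω hω => (hrc ω (hTs hω)).2.2.1)
    have hμt : μ.restrict f.target = μ := map_jacMeasure_restrict_target
    rw [← hμt, ← restrict_withDensity f.open_target.measurableSet, hU,
      Measure.restrict_biUnion_congr hTc]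
    intro ω hω
    rw [(hrc ω (hTs hω)).2.2.2, restrict_withDensity measurableSet_ball,
      withDensity_congr_ae (g := fun _ => (c ω : ℝ≥0∞)), withDensity_const]
    · rfl
    · filter_upwards [ae_restrict_mem measurableSet_ball] with ω' hω'
      rw [hconst ω (hTs hω) ω' hω']

theorem map_symm_map_jacMeasure {c : ℂ → NNReal}
    (hc : (jacMeasure f fx fy).map f = (volume.restrict f.target).withDensity fun ω => c ω) :
    AEMeasurable f.symm ((jacMeasure f fx fy).map f) ∧
    ((jacMeasure f fx fy).map f).map f.symm = jacMeasure f fx fy := by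
  have h1 : AEMeasurable f.symm ((jacMeasure f fx fy).map f) := by
    rw [hc]
    exact f.symm.aemeasurable_restrict_source.mono_ac (withDensity_absolutelyContinuous _ _)
  refine ⟨h1, ?_⟩
  rw [AEMeasurable.map_map_of_aemeasurable h1 aemeasurable_jacMeasure, Measure.map_congr (g := id),
    Measure.map_id]
  refine jacMeasure_absolutelyContinuous.ae_le ?_
  filter_upwards [ae_restrict_mem f.open_source.measurableSet] with z hz
  exact f.left_inv hz

/-- The structural data of the change of variables `ω = f z`. -/
structure IsDensity (f : OpenPartialHomeomorph ℂ ℂ) (fx fy : ℂ → ℂ) (c : ℂ → NNReal) : Prop where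
  pos : ∀ ω ∈ f.target, 0 < c ω
  locally_const : ∀ ω ∈ f.target, ∀ᶠ ω' in 𝓝 ω, c ω' = c ω
  map_eq : (jacMeasure f fx fy).map f = (volume.restrict f.target).withDensity fun ω => c ω

theorem IsDensity.continuousOn {c : ℂ → NNReal} (h : IsDensity f fx fy c) :
    ContinuousOn c f.target := fun ω hω =>
  ContinuousAt.continuousWithinAt
    ((continuousAt_const (y := c ω)).congr ((h.locally_const ω hω).mono fun _ e => e.symm))

theorem IsDensity.aemeasurable {c : ℂ → NNReal} (h : IsDensity f fx fy c) :
    AEMeasurable c (volume.restrict f.target) :=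
  h.continuousOn.aemeasurable f.open_target.measurableSet

theorem IsDensity.absolutelyContinuous {c : ℂ → NNReal} (h : IsDensity f fx fy c) :
    volume.restrict f.target ≪ (jacMeasure f fx fy).map f := by
  rw [h.map_eq]
  refine withDensity_absolutelyContinuous' h.aemeasurable.coe_nnreal_ennreal ?_
  filter_upwards [ae_restrict_mem f.open_target.measurableSet] with ω hω
  exact_mod_cast (h.pos ω hω).ne'

/-- `f.symm` carries `c dω` back to `J dz`, for which both Lebesgue null sets and `{J = 0}` are
null. As `c > 0`, their images in the target are Lebesgue null. -/
theorem IsDensity.ae_symm {c : ℂ → NNReal} (h : IsDensity f fx fy c)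
    (hw : HasW12LocPartials f.source f fx fy) {P : ℂ → Prop}
    (hP : ∀ᵐ z ∂volume.restrict f.source, P z) :
    ∀ᵐ ω ∂volume.restrict f.target, 0 < jac fx fy (f.symm ω) ∧ P (f.symm ω) := by
  obtain ⟨h1, h2⟩ := map_symm_map_jacMeasure h.map_eq
  have h3 : ∀ᵐ z ∂jacMeasure f fx fy, 0 < jac fx fy z ∧ P z := by
    rw [jacMeasure, ae_withDensity_iff' (aemeasurable_jac hw).ennreal_ofReal]
    filter_upwards [hP] with z hz h0
    exact ⟨by simpa using h0, hz⟩
  rw [← h2] at h3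
  exact h.absolutelyContinuous.ae_le (ae_of_ae_map h1 h3)

theorem IsDensity.aestronglyMeasurable_comp_symm {c : ℂ → NNReal} (h : IsDensity f fx fy c)
    {W : ℂ → ℂ} (hW : AEStronglyMeasurable W (volume.restrict f.source)) :
    AEStronglyMeasurable (fun ω => W (f.symm ω)) (volume.restrict f.target) := by
  obtain ⟨h1, h2⟩ := map_symm_map_jacMeasure h.map_eq
  have h3 : AEStronglyMeasurable W (((jacMeasure f fx fy).map f).map f.symm) := by
    rw [h2]; exact hW.mono_ac jacMeasure_absolutelyContinuous
  exact (h3.comp_aemeasurable h1).mono_ac h.absolutelyContinuous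

theorem IsDensity.integral_eq {c : ℂ → NNReal} (h : IsDensity f fx fy c)
    (hw : HasW12LocPartials f.source f fx fy)
    (hJ : ∀ᵐ z ∂volume.restrict f.source, 0 ≤ jac fx fy z) {G : ℂ → ℂ}
    (hG : AEStronglyMeasurable G (volume.restrict f.target)) :
    ∫ ω in f.target, (c ω : ℝ) • G ω = ∫ z in f.source, jac fx fy z • G (f z) := by
  rw [← integral_map_jacMeasure hw hJ, h.map_eq, integral_withDensity_eq_integral_smul₀ h.aemeasurable]
  · rfl
  · rw [h.map_eq]
    exact hG.mono_ac (withDensity_absolutelyContinuous _ _)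

theorem IsDensity.lintegral_eq {c : ℂ → NNReal} (h : IsDensity f fx fy c)
    (hw : HasW12LocPartials f.source f fx fy) {G : ℂ → ℝ≥0∞}
    (hG : AEMeasurable G (volume.restrict f.target)) :
    ∫⁻ ω in f.target, c ω * G ω = ∫⁻ z in f.source, ENNReal.ofReal (jac fx fy z) * G (f z) := by
  have hG' : AEMeasurable G ((jacMeasure f fx fy).map f) := by
    rw [h.map_eq]; exact hG.mono_ac (withDensity_absolutelyContinuous _ _)
  have h1 := lintegral_map' hG' aemeasurable_jacMeasure
  have h2 : AEMeasurable (fun z => G (f z)) (jacMeasure f fx fy) :=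
    hG'.comp_aemeasurable aemeasurable_jacMeasure
  rw [h.map_eq, lintegral_withDensity_eq_lintegral_mul₀ h.aemeasurable.coe_nnreal_ennreal hG,
    jacMeasure, lintegral_withDensity_eq_lintegral_mul₀' (aemeasurable_jac hw).ennreal_ofReal h2] at h1
  exact h1
end

/-! ### Sobolev regularity of the inverse -/

section
variable {f : OpenPartialHomeomorph ℂ ℂ} {fx fy : ℂ → ℂ} {c : ℂ → NNReal}

/-- If `W` is a function on the source with `|W|² J` bounded, then `W ∘ f⁻¹` is locally square
integrable on the target. -/
theorem IsDensity.isL2Loc_comp_symm (h : IsDensity f fx fy c)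
    (hw : HasW12LocPartials f.source f fx fy) {W : ℂ → ℂ}
    (hW : AEStronglyMeasurable W (volume.restrict f.source)) {C : ℝ}
    (hC : ∀ᵐ z ∂volume.restrict f.source, jac fx fy z * ‖W z‖ ^ 2 ≤ C) :
    IsL2Loc f.target fun ω => W (f.symm ω) := by
  intro S hS hSt
  have hm := h.aestronglyMeasurable_comp_symm hW
  have hmS : AEStronglyMeasurable (fun ω => W (f.symm ω)) (volume.restrict S) :=
    hm.mono_measure (Measure.restrict_mono hSt le_rfl)
  obtain ⟨hS', hS's⟩ := isCompact_symm_image f hS hSt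
  -- The density is continuous and positive, so `1 / c` is bounded on `S`; inserting `c` at the cost
  -- of `B` permits the change of variables.
  obtain ⟨B, hB⟩ := hS.exists_bound_of_continuousOn (f := fun ω => ((c ω : ℝ))⁻¹)
    ((NNReal.continuous_coe.comp_continuousOn (h.continuousOn.mono hSt)).inv₀ fun ω hω =>
      NNReal.coe_ne_zero.2 (h.pos ω (hSt hω)).ne')
  have hB1 (ω : ℂ) (hω : ω ∈ S) : 1 ≤ ENNReal.ofReal B * c ω := by
    have h0 := h.pos ω (hSt hω)
    have h1 : (c ω : ℝ)⁻¹ ≤ B := (le_abs_self _).trans (hB ω hω)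
    have h2 : 1 ≤ B * c ω := by rwa [inv_le_iff_one_le_mul₀ (by exact_mod_cast h0)] at h1
    rw [← ENNReal.ofReal_coe_nnreal, ← ENNReal.ofReal_mul ((inv_nonneg.2 (c ω).2).trans h1)]
    exact ENNReal.one_le_ofReal.2 h2
  rw [memLp_two_iff_integrable_sq_norm hmS]
  refine ⟨(hmS.norm.pow 2), ?_⟩
  set G : ℂ → ℝ≥0∞ := S.indicator fun ω => ENNReal.ofReal (‖W (f.symm ω)‖ ^ 2) with hGdef
  have hG : AEMeasurable G (volume.restrict f.target) :=
    (hm.norm.aemeasurable.pow_const 2).ennreal_ofReal.indicator hS.measurableSet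
  have key := h.lintegral_eq hw hG
  have step : ∫⁻ ω in S, ‖‖W (f.symm ω)‖ ^ 2‖ₑ ≤
      ∫⁻ ω in f.target, ENNReal.ofReal B * (c ω * G ω) := by
    calc ∫⁻ ω in S, ‖‖W (f.symm ω)‖ ^ 2‖ₑ
        ≤ ∫⁻ ω in S, ENNReal.ofReal B * (c ω * G ω) := by
          refine setLIntegral_mono' hS.measurableSet fun ω hω => ?_
          rw [← mul_assoc, hGdef, Set.indicator_of_mem hω, Real.enorm_of_nonneg (by positivity)]
          exact le_mul_of_one_le_left' (hB1 ω hω)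
      _ ≤ _ := lintegral_mono_set hSt
  refine step.trans_lt ?_
  rw [lintegral_const_mul' _ _ ENNReal.ofReal_ne_top, key]
  refine ENNReal.mul_lt_top ENNReal.ofReal_lt_top ?_
  have bound : ∫⁻ z in f.source, ENNReal.ofReal (jac fx fy z) * G (f z) ≤
      ∫⁻ z in f.source, (f.symm '' S).indicator (fun _ => ENNReal.ofReal C) z := by
    refine lintegral_mono_ae ?_
    filter_upwards [hC, ae_restrict_mem f.open_source.measurableSet] with z hz hzs
    by_cases hfz : f z ∈ S
    · have hzS : z ∈ f.symm '' S := ⟨f z, hfz, f.left_inv hzs⟩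
      rw [Set.indicator_of_mem hzS, hGdef, Set.indicator_of_mem hfz,
        f.left_inv hzs, ← ENNReal.ofReal_mul' (by positivity)]
      exact ENNReal.ofReal_le_ofReal hz
    · rw [hGdef, Set.indicator_of_notMem hfz, mul_zero]
      exact zero_le
  refine bound.trans_lt ?_
  rw [lintegral_indicator_const hS'.measurableSet]
  exact ENNReal.mul_lt_top ENNReal.ofReal_lt_top
    ((Measure.restrict_apply_le _ _).trans_lt hS'.measure_lt_top)

theorem integrableOn_pullback_mul {φ : ℂ → ℝ} (hφ : Continuous φ) (hφc : HasCompactSupport φ)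
    (hφs : tsupport φ ⊆ f.target) {u : ℂ → ℂ} (hu : IsL2Loc f.source u) :
    IntegrableOn (fun z => (φ (f z) : ℂ) * u z) f.source := by
  obtain ⟨hS, hSs⟩ := isCompact_symm_image f hφc.isCompact hφs
  have hfin : IsFiniteMeasure ((volume : Measure ℂ).restrict (f.symm '' tsupport φ)) :=
    ⟨by rw [Measure.restrict_apply_univ]; exact hS.measure_lt_top⟩
  obtain ⟨B, hB⟩ := hφc.exists_bound_of_continuous hφ
  have h1 : IntegrableOn u (f.symm '' tsupport φ) :=
    memLp_one_iff_integrable.1 ((hu _ hS hSs).mono_exponent (by norm_num))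
  have h2 : IntegrableOn (fun z => (φ (f z) : ℂ) * u z) (f.symm '' tsupport φ) := by
    refine h1.bdd_mul (c := B) ?_ (Eventually.of_forall fun z => ?_)
    · exact ((Complex.continuous_ofReal.comp hφ).comp_continuousOn
        (f.continuousOn.mono hSs)).aestronglyMeasurable hS.measurableSet
    · rw [Complex.norm_real]; exact hB _
  refine h2.of_forall_sdiff_eq_zero f.open_source.measurableSet fun z hz => ?_
  rw [image_eq_zero_of_notMem_tsupport fun h => hz.2 ⟨f z, h, f.left_inv hz.1⟩, Complex.ofReal_zero,
    zero_mul]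

/-- The partial derivative in the direction `e` of the inverse, in the coordinates of the
source. -/
noncomputable def invPartial (fx fy : ℂ → ℂ) (e z : ℂ) : ℂ :=
  ((((conj e * fy z).im : ℝ) : ℂ) - Complex.I * (((conj e * fx z).im : ℝ) : ℂ)) / (jac fx fy z : ℂ)

theorem aestronglyMeasurable_invPartial (hw : HasW12LocPartials f.source f fx fy) (e : ℂ) :
    AEStronglyMeasurable (invPartial fx fy e) (volume.restrict f.source) := by
  have h1 := (hw.memL2_x.aestronglyMeasurable f.open_source).aemeasurable
  have h2 := (hw.memL2_y.aestronglyMeasurable f.open_source).aemeasurable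
  have h3 := aemeasurable_jac hw
  have hm (u : ℂ → ℂ) (hu : AEMeasurable u (volume.restrict f.source)) :
      AEMeasurable (fun z => (((conj e * u z).im : ℝ) : ℂ)) (volume.restrict f.source) :=
    (Complex.measurable_ofReal.comp Complex.measurable_im).comp_aemeasurable (hu.const_mul _)
  exact (((hm fy h2).sub ((hm fx h1).const_mul _)).div
    (Complex.measurable_ofReal.comp_aemeasurable h3)).aestronglyMeasurable

/-- The numerator of `invPartial` is at most `‖fx‖ + ‖fy‖`, whose square is at most `2 C J`; the
denominator contributes `J²`. -/
theorem jac_mul_norm_invPartial_sq_le {C : ℝ} {e z : ℂ} (hC : 0 ≤ C) (he : ‖e‖ ≤ 1)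
    (hdist : ‖fx z‖ ^ 2 + ‖fy z‖ ^ 2 ≤ C * jac fx fy z) (hJ : 0 ≤ jac fx fy z) :
    jac fx fy z * ‖invPartial fx fy e z‖ ^ 2 ≤ 2 * C := by
  rcases hJ.eq_or_lt with h0 | h0
  · rw [← h0, zero_mul]; positivity
  have him (u : ℂ) : ‖(((conj e * u).im : ℝ) : ℂ)‖ ≤ ‖u‖ := by
    rw [Complex.norm_real]
    refine (Complex.abs_im_le_norm _).trans ?_
    rw [norm_mul, RCLike.norm_conj]
    exact mul_le_of_le_one_left (norm_nonneg _) he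
  have h1 : ‖invPartial fx fy e z‖ ≤ (‖fy z‖ + ‖fx z‖) / jac fx fy z := by
    rw [invPartial, norm_div, Complex.norm_real, Real.norm_of_nonneg hJ]
    gcongr
    refine (norm_sub_le _ _).trans (add_le_add (him _) ?_)
    rw [norm_mul, Complex.norm_I, one_mul]
    exact him _
  have h2 : ‖invPartial fx fy e z‖ ^ 2 ≤ ((‖fy z‖ + ‖fx z‖) / jac fx fy z) ^ 2 := by gcongr
  have h3 : jac fx fy z * ((‖fy z‖ + ‖fx z‖) / jac fx fy z) ^ 2 =
      (‖fy z‖ + ‖fx z‖) ^ 2 / jac fx fy z := by field_simp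
  calc _ ≤ jac fx fy z * ((‖fy z‖ + ‖fx z‖) / jac fx fy z) ^ 2 := by gcongr
    _ ≤ 2 * C := by
      rw [h3, div_le_iff₀ h0]
      nlinarith [sq_nonneg (‖fy z‖ - ‖fx z‖)]

/-- Because `c` is locally constant, division by it keeps test functions smooth and commutes with
differentiation, so the unknown density can be absorbed. -/
theorem IsDensity.contDiff_div (h : IsDensity f fx fy c) {φ : ℂ → ℝ}
    (hφ : ContDiff ℝ ((⊤ : ℕ∞) : WithTop ℕ∞) φ) (hφs : tsupport φ ⊆ f.target) :
    ContDiff ℝ ((⊤ : ℕ∞) : WithTop ℕ∞) (fun ω => φ ω / c ω) ∧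
      ∀ ω ∈ f.target, ∀ e, (c ω : ℝ) * fderiv ℝ (fun ω => φ ω / c ω) ω e = fderiv ℝ φ ω e := by
  have hloc (ω : ℂ) (hω : ω ∈ f.target) :
      (fun ω => φ ω / c ω) =ᶠ[𝓝 ω] fun ω' => φ ω' / (c ω : ℝ) := by
    filter_upwards [h.locally_const ω hω] with ω' hω'
    rw [hω']
  refine ⟨contDiff_iff_contDiffAt.2 fun ω => ?_, fun ω hω e => ?_⟩
  · by_cases hω : ω ∈ f.target
    · exact (hφ.contDiffAt.div_const _).congr_of_eventuallyEq (hloc ω hω)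
    · have h0 : (fun ω => φ ω / c ω) =ᶠ[𝓝 ω] fun _ => 0 := by
        filter_upwards [notMem_tsupport_iff_eventuallyEq.1 fun hm => hω (hφs hm)] with ω' hω'
        rw [hω', Pi.zero_apply, zero_div]
      exact contDiffAt_const.congr_of_eventuallyEq h0
  · have hc : (c ω : ℝ) ≠ 0 := by exact_mod_cast (h.pos ω hω).ne'
    have hd : HasFDerivAt (fun ω' => φ ω' / (c ω : ℝ)) ((c ω : ℝ)⁻¹ • fderiv ℝ φ ω) ω := by
      simpa only [div_eq_mul_inv] using
        (hφ.differentiable (by simp) ω).hasFDerivAt.mul_const (c ω : ℝ)⁻¹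
    rw [(hloc ω hω).fderiv_eq, hd.fderiv]
    change (c ω : ℝ) * ((c ω : ℝ)⁻¹ * fderiv ℝ φ ω e) = _
    rw [mul_inv_cancel_left₀ hc]

/-- This is `integral_pullback_jacobian` with `l` the identity and test function `ψ = φ / c`, moved
to the target by the change of variables, where the weight `c` restores `φ`. -/
theorem IsDensity.hasWeakDirDeriv_symm (h : IsDensity f fx fy c)
    (hw : HasW12LocPartials f.source f fx fy) {C : ℝ}
    (hdist : ∀ᵐ z ∂volume.restrict f.source, ‖fx z‖ ^ 2 + ‖fy z‖ ^ 2 ≤ C * jac fx fy z)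
    (hJ : ∀ᵐ z ∂volume.restrict f.source, 0 ≤ jac fx fy z) (e : ℂ) :
    HasWeakDirDeriv f.target f.symm e fun ω => invPartial fx fy e (f.symm ω) := by
  intro φ hφ hφc hφs
  have ht := f.open_target.measurableSet
  obtain ⟨hψ, hψd⟩ := h.contDiff_div hφ hφs
  set ψ : ℂ → ℝ := fun ω => φ ω / c ω with hψdef
  have hψ0 (ω : ℂ) (h0 : φ ω = 0) : ψ ω = 0 := by rw [hψdef]; simp only [h0, zero_div]
  have hψc : HasCompactSupport ψ := hφc.of_eq_zero hψ0
  have hψs : tsupport ψ ⊆ f.target :=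
    (closure_mono (Function.support_subset_iff'.2 fun ω h0 =>
      hψ0 ω (Function.notMem_support.1 h0))).trans hφs
  have hfx := integrableOn_pullback_mul hψ.continuous hψc hψs hw.memL2_x
  have hfy := integrableOn_pullback_mul hψ.continuous hψc hψs hw.memL2_y
  have him (u : ℂ → ℂ) (hu : IntegrableOn (fun z => (ψ (f z) : ℂ) * u z) f.source) :
      IntegrableOn (fun z => (ψ (f z) : ℂ) * (((conj e * u z).im : ℝ) : ℂ)) f.source := by
    have h1 := (hu.const_mul (conj e)).im.ofReal (𝕜 := ℂ)
    refine h1.congr (Eventually.of_forall fun z => ?_)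
    change (((conj e * ((ψ (f z) : ℂ) * u z)).im : ℝ) : ℂ) = _
    rw [mul_left_comm, Complex.im_ofReal_mul, Complex.ofReal_mul]
  have key := integral_pullback_jacobian f hw hψ hψc hψs contDiff_id e
  simp only [fderiv_id, ContinuousLinearMap.id_apply, id] at key
  have L := h.integral_eq hw hJ (G := fun ω => fderiv ℝ ψ ω e • f.symm ω)
    ((((hψ.continuous_fderiv (by simp)).clm_apply continuous_const).continuousOn.smul
      f.continuousOn_symm).aestronglyMeasurable ht)
  have R := h.integral_eq hw hJ (G := fun ω => ψ ω • invPartial fx fy e (f.symm ω))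
    (hψ.continuous.aestronglyMeasurable.smul
      (h.aestronglyMeasurable_comp_symm (aestronglyMeasurable_invPartial hw e)))
  have e1 : ∫ ω in f.target, (fderiv ℝ φ ω e) • f.symm ω =
      ∫ ω in f.target, (c ω : ℝ) • (fderiv ℝ ψ ω e • f.symm ω) :=
    setIntegral_congr_fun ht fun ω hω => by simp only [smul_smul, hψd ω hω]
  have e2 : ∫ ω in f.target, φ ω • invPartial fx fy e (f.symm ω) =
      ∫ ω in f.target, (c ω : ℝ) • (ψ ω • invPartial fx fy e (f.symm ω)) :=
    setIntegral_congr_fun ht fun ω hω => by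
      have hc : (c ω : ℝ) ≠ 0 := by exact_mod_cast (h.pos ω hω).ne'
      simp only [smul_smul, hψdef, mul_div_cancel₀ _ hc]
  have e3 : ∫ z in f.source, jac fx fy z • (fderiv ℝ ψ (f z) e • f.symm (f z)) =
      ∫ z in f.source, (fderiv ℝ ψ (f z) e • z) * (((conj (fx z) * fy z).im : ℝ) : ℂ) :=
    setIntegral_congr_fun f.open_source.measurableSet fun z hz => by
      simp only [f.left_inv hz, jac]
      rw [Complex.real_smul, mul_comm]
  have e4 : ∫ z in f.source, jac fx fy z • (ψ (f z) • invPartial fx fy e (f.symm (f z))) =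
      ∫ z in f.source, ((ψ (f z) : ℂ) * (1 * (((conj e * fy z).im : ℝ) : ℂ)) -
        (ψ (f z) : ℂ) * (Complex.I * (((conj e * fx z).im : ℝ) : ℂ))) := by
    refine integral_congr_ae ?_
    filter_upwards [hdist, ae_restrict_mem f.open_source.measurableSet] with z hz hzs
    simp only [f.left_inv hzs, invPartial, Complex.real_smul]
    -- Where `J = 0` the distortion inequality gives `fx = fy = 0`, so the zero from division by
    -- zero is the correct value.
    by_cases h0 : jac fx fy z = 0
    · rw [h0, mul_zero] at hz
      have hx : fx z = 0 := norm_eq_zero.1 (by nlinarith [sq_nonneg ‖fx z‖, sq_nonneg ‖fy z‖])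
      have hy : fy z = 0 := norm_eq_zero.1 (by nlinarith [sq_nonneg ‖fx z‖, sq_nonneg ‖fy z‖])
      simp [h0, hx, hy]
    · have h0' : (jac fx fy z : ℂ) ≠ 0 := by exact_mod_cast h0
      field_simp
  rw [e1, e2, L, R, e3, e4, key, integral_sub]
  · simpa only [one_mul, IntegrableOn] using him fy hfy
  · refine ((him fx hfx).const_mul Complex.I).congr (Eventually.of_forall fun z => ?_)
    change Complex.I * _ = _
    ring
end

/-! ### The Beltrami equation for the inverse -/

section
variable {fx fy : ℂ → ℂ}

theorem wirtinger_add_wirtingerBar (z : ℂ) :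
    wirtinger fx fy z + wirtingerBar fx fy z = fx z := by
  unfold wirtinger wirtingerBar; ring

theorem I_mul_wirtinger_sub_wirtingerBar (z : ℂ) :
    Complex.I * (wirtinger fx fy z - wirtingerBar fx fy z) = fy z := by
  unfold wirtinger wirtingerBar
  linear_combination -(fy z) * Complex.I_sq

theorem jac_eq_norm_sq_sub (z : ℂ) :
    jac fx fy z = ‖wirtinger fx fy z‖ ^ 2 - ‖wirtingerBar fx fy z‖ ^ 2 := by
  rw [jac, ← wirtinger_add_wirtingerBar (fx := fx) (fy := fy) z,
    ← I_mul_wirtinger_sub_wirtingerBar (fx := fx) (fy := fy) z, Complex.sq_norm, Complex.sq_norm,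
    Complex.normSq_apply, Complex.normSq_apply]
  simp
  ring

theorem norm_sq_add_norm_sq_eq (z : ℂ) : ‖fx z‖ ^ 2 + ‖fy z‖ ^ 2 =
    2 * (‖wirtinger fx fy z‖ ^ 2 + ‖wirtingerBar fx fy z‖ ^ 2) := by
  rw [← wirtinger_add_wirtingerBar (fx := fx) (fy := fy) z,
    ← I_mul_wirtinger_sub_wirtingerBar (fx := fx) (fy := fy) z]
  simp only [Complex.sq_norm, Complex.normSq_apply]
  simp
  ring

/-- Links the two halves: with `q = h p`, the right sides are `invDiff h p` and `invDiffBar h p`. -/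
theorem invPartial_wirtinger (z : ℂ) :
    (invPartial fx fy 1 z - Complex.I * invPartial fx fy Complex.I z) / 2 =
      star (wirtinger fx fy z) / (jac fx fy z : ℂ) ∧
    (invPartial fx fy 1 z + Complex.I * invPartial fx fy Complex.I z) / 2 =
      -wirtingerBar fx fy z / (jac fx fy z : ℂ) := by
  have h1 := wirtinger_add_wirtingerBar (fx := fx) (fy := fy) z
  have h2 := I_mul_wirtinger_sub_wirtingerBar (fx := fx) (fy := fy) z
  set p := wirtinger fx fy z
  set q := wirtingerBar fx fy z
  simp only [invPartial, ← h1, ← h2, div_eq_mul_inv]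
  set d := (jac fx fy z : ℂ)⁻¹
  have e1 : ((((conj 1 * (Complex.I * (p - q))).im : ℝ) : ℂ) -
      Complex.I * (((conj 1 * (p + q)).im : ℝ) : ℂ)) -
      Complex.I * ((((conj Complex.I * (Complex.I * (p - q))).im : ℝ) : ℂ) -
      Complex.I * (((conj Complex.I * (p + q)).im : ℝ) : ℂ)) = 2 * star p := by
    apply Complex.ext <;> simp <;> ring
  have e2 : ((((conj 1 * (Complex.I * (p - q))).im : ℝ) : ℂ) -
      Complex.I * (((conj 1 * (p + q)).im : ℝ) : ℂ)) +
      Complex.I * ((((conj Complex.I * (Complex.I * (p - q))).im : ℝ) : ℂ) -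
      Complex.I * (((conj Complex.I * (p + q)).im : ℝ) : ℂ)) = 2 * -q := by
    apply Complex.ext <;> simp <;> ring
  constructor
  · linear_combination (d / 2) * e1
  · linear_combination (d / 2) * e2
end

theorem solvesBeltrami_symm {K : ℝ} (hK : 1 ≤ K) {H : ℂ → ℂ → ℂ} (f : OpenPartialHomeomorph ℂ ℂ)
    (hH : IsStructureFunction f.source ((K - 1) / (K + 1)) H)
    (hf : SolvesBeltrami f.source H f) :
    SolvesBeltrami f.target (fun ω ξ => invStructure (H (f.symm ω)) ξ) f.symm := by
  obtain ⟨fx, fy, hw, heq⟩ := hf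
  have hqc : ∀ᵐ z ∂volume.restrict f.source,
      IsQCPair K (wirtinger fx fy z) (wirtingerBar fx fy z) := by
    filter_upwards [heq, ae_restrict_mem f.open_source.measurableSet] with z hz hzs
    rw [hz]
    exact isQCPair_of_lipschitz hK (hH.lipschitz_right z hzs) (hH.map_zero z hzs) _
  have hJ : ∀ᵐ z ∂volume.restrict f.source, 0 ≤ jac fx fy z := by
    filter_upwards [hqc] with z hz
    rw [jac_eq_norm_sq_sub]
    unfold IsQCPair at hz
    exact nonneg_of_mul_nonneg_right ((sq_nonneg _).trans hz) (by linarith)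
  have hdist : ∀ᵐ z ∂volume.restrict f.source,
      ‖fx z‖ ^ 2 + ‖fy z‖ ^ 2 ≤ (2 * K) * jac fx fy z := by
    filter_upwards [hqc] with z hz
    rw [jac_eq_norm_sq_sub, norm_sq_add_norm_sq_eq]
    unfold IsQCPair at hz
    nlinarith [mul_nonneg (norm_nonneg (wirtinger fx fy z)) (norm_nonneg (wirtingerBar fx fy z))]
  obtain ⟨c, hc1, hc2, hc3⟩ := exists_density hw hdist hJ
  have hc : IsDensity f fx fy c := ⟨hc1, hc2, hc3⟩
  have hL2 (e : ℂ) (he : ‖e‖ ≤ 1) :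
      IsL2Loc f.target fun ω => invPartial fx fy e (f.symm ω) := by
    refine hc.isL2Loc_comp_symm hw (aestronglyMeasurable_invPartial hw e) (C := 2 * (2 * K)) ?_
    filter_upwards [hdist, hJ] with z h1 h2
    exact jac_mul_norm_invPartial_sq_le (by linarith) he h1 h2
  have hsymm : IsL2Loc f.target f.symm := fun S hS hSt => by
    have hfin : IsFiniteMeasure ((volume : Measure ℂ).restrict S) :=
      ⟨by rw [Measure.restrict_apply_univ]; exact hS.measure_lt_top⟩
    obtain ⟨B, hB⟩ := hS.exists_bound_of_continuousOn (f.continuousOn_symm.mono hSt)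
    exact MemLp.of_bound ((f.continuousOn_symm.mono hSt).aestronglyMeasurable hS.measurableSet) B
      ((ae_restrict_mem hS.measurableSet).mono hB)
  refine ⟨fun ω => invPartial fx fy 1 (f.symm ω), fun ω => invPartial fx fy Complex.I (f.symm ω),
    ⟨hsymm, hL2 1 (by simp), hL2 Complex.I (by simp),
      hc.hasWeakDirDeriv_symm hw hdist hJ 1, hc.hasWeakDirDeriv_symm hw hdist hJ Complex.I⟩, ?_⟩
  filter_upwards [hc.ae_symm hw heq, ae_restrict_mem f.open_target.measurableSet] with ω hω hωt
  obtain ⟨hpos, hz⟩ := hω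
  have hs := f.map_target hωt
  obtain ⟨h1, h2⟩ := invPartial_wirtinger (fx := fx) (fy := fy) (f.symm ω)
  -- Positivity of `J` at `f.symm ω` excludes `p = 0`, so the value of `invStructure` is the one
  -- given by the inverse pair.
  have hp : wirtinger fx fy (f.symm ω) ≠ 0 := by
    intro h0
    rw [jac_eq_norm_sq_sub, h0, norm_zero] at hpos
    nlinarith [sq_nonneg ‖wirtingerBar fx fy (f.symm ω)‖]
  have key := invStructure_invDiff hK (hH.lipschitz_right _ hs) (hH.map_zero _ hs) hp
  rw [jac_eq_norm_sq_sub, hz] at h1 h2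
  change (_ + _) / 2 = invStructure (H (f.symm ω)) ((_ - _) / 2)
  rw [h1, h2]
  exact key.symm

theorem lemma3p1 (K : ℝ) (hK : 1 ≤ K) :
    ∃ c : ℝ, 0 < c ∧
      ∀ (Ω : Set ℂ), IsOpen Ω →
      ∀ H : ℂ → ℂ → ℂ, IsStructureFunction Ω ((K - 1) / (K + 1)) H →
      ∃ Hs : ℂ → ℂ → ℂ,
        IsStructureFunction Ω ((K ^ 3 - 1) / (K ^ 3 + 1)) Hs ∧
        (∀ α M : ℝ, 0 < α → α < 1 →
          HolderCondition Ω α M ((K - 1) / (K + 1)) H →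
          HolderCondition Ω α (c * M) ((K ^ 3 - 1) / (K ^ 3 + 1)) Hs) ∧
        ∀ f : OpenPartialHomeomorph ℂ ℂ, f.source = Ω →
          SolvesBeltrami Ω H f →
          SolvesBeltrami f.target (fun ω ξ => Hs (f.symm ω) ξ) f.symm := by
  refine ⟨4 * K ^ 2, by positivity, fun Ω hΩ H hH => ⟨fun z => invStructure (H z),
    hH.inv hK hΩ, fun α M _ _ h => hH.holderCondition_inv hK h, ?_⟩⟩
  rintro f rfl hf
  exact solvesBeltrami_symm hK f hH hf
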